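/- Let $d\ge 1$ and let $c_1,c_2,c_3,c_4\in[0,+\infty)$ with $0<c_1\le c_3$. Write $\mathbb{R}^{d\times d}_{\rm sym}$ for the symmetric $d\times d$ real matrices with the Frobenius norm $|\cdot|$, $\mathbb{S}^{d-1}$ for the unit sphere of $\mathbb{R}^d$, and $(a\odot b)_{ij}=\frac12(a_ib_j+a_jb_i)$ for $a,b\in\mathbb{R}^d$. Let $f\colon\mathbb{R}^{d\times d}_{\rm sym}\to[0,+\infty)$ and $g\colon\mathbb{R}^d\times\mathbb{S}^{d-1}\to[0,+\infty)$ be Borel functions such that, for all $A\in\mathbb{R}^{d\times d}_{\rm sym}$, $\zeta\in\mathbb{R}^d$, $\nu\in\mathbb{S}^{d-1}$ and $t\ge 0$, $$c_1|A|-c_2\le f(A)\le c_3|A|+c_4,\qquad g(\zeta,\nu)=g(-\zeta,-\nu),$$ $$c_1|\zeta\odot\nu|\le g(\zeta,\nu)\le c_3|\zeta\odot\nu|,\qquad g(t\zeta,\nu)=t\,g(\zeta,\nu).$$ Let $f^\infty(A):=\limsup_{t\to+\infty}f(tA)/t$ be the recession function of $f$. For an open set $U\subset\mathbb{R}^d$,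 let ${\rm BD}(U)$ be the set of all $u\in L^1(U;\mathbb{R}^d)$ whose distributional symmetric gradient $Eu=\frac12(Du+Du^T)$ is a bounded Radon measure on $U$, and let ${\rm BD}_{\rm loc}(U)$ be the set of all measurable $u\colon U\to\mathbb{R}^d$ with $u|_V\in{\rm BD}(V)$ for every open $V$ whose closure is a compact subset of $U$. For $u\in{\rm BD}_{\rm loc}(U)$ let $\mathcal{E}u$ be the density of the absolutely continuous part of $Eu$ with respect to Lebesgue measure; let $J_u\subset U$ be the jump set of $u$, that is, the set of all $x\in U$ for which there are $u^+(x)\ne u^-(x)$ in $\mathbb{R}^d$ and $\nu_u(x)\in\mathbb{S}^{d-1}$ with $$\lim_{\rho\to0^+}\rho^{-d}\int_{\{y\in B_\rho(x)\,:\,\pm(y-x)\cdot\nu_u(x)>0\}}|u(y)-u^\pm(x)|\,{\rm d}y=0;$$ let $[u]:=u^+-u^-$ on $J_u$; and let the Cantor part $E^cu$ be the restriction to $U\setminus J_u$ of the singular part of $Eu$ with respect to Lebesgue measure. Define $$F^{f,g}(u,U):=\int_U f(\mathcal{E}u)\,{\rm d}x+\int_U f^\infty\Big(\frac{{\rm d}E^cu}{{\rm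 d}|E^cu|}\Big)\,{\rm d}|E^cu|+\int_{J_u\cap U}g([u],\nu_u)\,{\rm d}\mathcal{H}^{d-1}$$ if $u\in{\rm BD}_{\rm loc}(U)$, and $F^{f,g}(u,U):=+\infty$ otherwise. Assume that there is a non-empty bounded open set $U\subset\mathbb{R}^d$ such that $F^{f,g}(\cdot,U)$ is lower semicontinuous on $L^1(U;\mathbb{R}^d)$ with respect to the $L^1$ norm. Then $$g(\zeta,\nu)=f^\infty(\zeta\odot\nu)\qquad\text{for every }\zeta\in\mathbb{R}^d\text{ and }\nu\in\mathbb{S}^{d-1}.$$ -/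

import Mathlib

open MeasureTheory Set Filter Topology
open scoped NNReal ENNReal ContDiff

noncomputable section

namespace BDEnergy

/-- Euclidean space `ℝᵈ`. -/
abbrev Euc (d : ℕ) : Type := EuclideanSpace ℝ (Fin d)

/-- The unit sphere of `ℝᵈ`. -/
abbrev Sph (d : ℕ) : Type := Metric.sphere (0 : Euc d) 1

/-- The linear space of symmetric `d × d` real matrices. -/
def symSubmodule (d : ℕ) : Submodule ℝ (Matrix (Fin d) (Fin d) ℝ) where
  carrier := {A | A.IsSymm}
  add_mem' hA hB := hA.add hB
  zero_mem' := Matrix.isSymm_zero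
  smul_mem' c _ hA := hA.smul c

/-- Symmetric `d × d` real matrices, with the usual topology of a finite dimensional space. -/
abbrev SymMat (d : ℕ) : Type := symSubmodule d

/-- The Borel `σ`-algebra on symmetric matrices. -/
instance instMeasurableSpaceSymMat (d : ℕ) : MeasurableSpace (SymMat d) := borel (SymMat d)

instance instBorelSpaceSymMat (d : ℕ) : BorelSpace (SymMat d) := ⟨rfl⟩

/-- The Frobenius norm of a symmetric matrix. -/
def frob {d : ℕ} (A : SymMat d) : ℝ := Real.sqrt (∑ i, ∑ j, (A.1 i j) ^ 2)

/-- The symmetrised tensor product `(a ⊙ b)ᵢⱼ = (aᵢ bⱼ + aⱼ bᵢ) / 2`. -/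
def symTensor {d : ℕ} (a b : Euc d) : SymMat d :=
  ⟨Matrix.of fun i j => (a i * b j + a j * b i) / 2, by
    refine Matrix.IsSymm.ext fun i j => ?_
    simp only [Matrix.of_apply]
    ring⟩

/-- The recession function `f^∞(A) = limsup_{t → +∞} f(tA) / t`, with values in `[0, +∞]`
(it is finite as soon as `f` has at most linear growth). -/
def recession {d : ℕ} (f : SymMat d → ℝ≥0) (A : SymMat d) : ℝ≥0∞ :=
  limsup (fun t : ℝ => (f (t • A) : ℝ≥0∞) / ENNReal.ofReal t) atTop

/-- `IsSymGrad U u lam s`: the distributional symmetric gradient `Eu = (Du + Duᵀ) / 2` of `u` on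
`U` is the matrix valued Radon measure `s lam`, written in polar form: `lam` is a positive Radon
measure on `U` and `|s| = 1` holds `lam`-almost everywhere. Thus `lam` is the total variation
`|Eu|` and `s` is the density `dEu / d|Eu|`; every matrix valued Radon measure on `U` has this
form, with `lam` unique and `s` unique up to `lam`-null sets. -/
structure IsSymGrad {d : ℕ} (U : Set (Euc d)) (u : Euc d → Euc d)
    (lam : Measure (Euc d)) (s : Euc d → SymMat d) : Prop where
  compl_eq_zero : lam Uᶜ = 0
  finite_on_compacts : ∀ K : Set (Euc d), IsCompact K → K ⊆ U → lam K < ⊤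
  measurable_density : Measurable s
  norm_density : ∀ᵐ x ∂lam, frob (s x) = 1
  weak_eq : ∀ φ : Euc d → ℝ, ContDiff ℝ ∞ φ → HasCompactSupport φ → tsupport φ ⊆ U →
    ∀ i j : Fin d,
      ∫ x in U, (u x i * fderiv ℝ φ x (EuclideanSpace.single j 1)
          + u x j * fderiv ℝ φ x (EuclideanSpace.single i 1)) / 2
        = - ∫ x, φ x * (s x).1 i j ∂lam

/-- `u|_U ∈ BD(U)`: `u` is integrable on `U` and `Eu` is a bounded Radon measure on `U`. -/
def MemBD {d : ℕ} (U : Set (Euc d)) (u : Euc d → Euc d) : Prop :=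
  IntegrableOn u U ∧ ∃ lam s, IsSymGrad U u lam s ∧ lam U < ⊤

/-- `u|_U ∈ BD_loc(U)`: `u` is Lebesgue measurable on `U` and belongs to `BD(V)` for all open sets
`V` whose closure is compact and contained in `U`. -/
def MemBDLoc {d : ℕ} (U : Set (Euc d)) (u : Euc d → Euc d) : Prop :=
  AEStronglyMeasurable u (volume.restrict U) ∧
    ∀ V : Set (Euc d), IsOpen V → IsCompact (closure V) → closure V ⊆ U → MemBD V u

open Classical in
/-- The pair `(|Eu|, dEu / d|Eu|)` on `U`. -/
def symGrad {d : ℕ} (U : Set (Euc d)) (u : Euc d → Euc d) :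
    Measure (Euc d) × (Euc d → SymMat d) :=
  if h : ∃ p : Measure (Euc d) × (Euc d → SymMat d), IsSymGrad U u p.1 p.2 then h.choose
  else (0, fun _ => 0)

/-- The total variation measure `|Eu|` on `U`. -/
def totalVar {d : ℕ} (U : Set (Euc d)) (u : Euc d → Euc d) : Measure (Euc d) := (symGrad U u).1

/-- The polar density `dEu / d|Eu|` on `U`. -/
def polarDensity {d : ℕ} (U : Set (Euc d)) (u : Euc d → Euc d) : Euc d → SymMat d :=
  (symGrad U u).2

/-- The density `ℰu` with respect to Lebesgue measure of the absolutely continuous part of `Eu`. -/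
def absContDensity {d : ℕ} (U : Set (Euc d)) (u : Euc d → Euc d) (x : Euc d) : SymMat d :=
  ((totalVar U u).rnDeriv volume x).toReal • polarDensity U u x

/-- `(a, b, ν)` is a triple `(u⁺(x), u⁻(x), ν_u(x))` of one-sided limits and normal of `u` at the
jump point `x`. -/
def IsJumpTriple {d : ℕ} (u : Euc d → Euc d) (x : Euc d) (a b : Euc d) (ν : Sph d) : Prop :=
  a ≠ b ∧
  Tendsto (fun ρ : ℝ =>
      (∫⁻ y in Metric.ball x ρ ∩ {y | 0 < inner ℝ (y - x) (ν : Euc d)}, ‖u y - a‖ₑ)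
        / ENNReal.ofReal (ρ ^ d)) (𝓝[>] 0) (𝓝 0) ∧
  Tendsto (fun ρ : ℝ =>
      (∫⁻ y in Metric.ball x ρ ∩ {y | inner ℝ (y - x) (ν : Euc d) < 0}, ‖u y - b‖ₑ)
        / ENNReal.ofReal (ρ ^ d)) (𝓝[>] 0) (𝓝 0)

/-- The jump set of `u` in `U`. -/
def jumpSet {d : ℕ} (U : Set (Euc d)) (u : Euc d → Euc d) : Set (Euc d) :=
  {x | x ∈ U ∧ ∃ a b ν, IsJumpTriple u x a b ν}

/-- The total variation `|E^c u|` of the Cantor part `E^c u`, the restriction to `U \ J_u` of the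
singular part of `Eu`. The density `dE^c u / d|E^c u|` is the polar density of `Eu`. -/
def cantorVar {d : ℕ} (U : Set (Euc d)) (u : Euc d → Euc d) : Measure (Euc d) :=
  ((totalVar U u).singularPart volume).restrict (U \ jumpSet U u)

open Classical in
/-- The surface density `g([u], ν_u)` with `[u] = u⁺ - u⁻`. The triple is unique up to exchanging
`u⁺` and `u⁻` and changing the sign of `ν_u`, so that the value does not depend on the choice
when `g(ζ, ν) = g(-ζ, -ν)`. -/
def surfaceDensity {d : ℕ} (g : Euc d → Sph d → ℝ≥0) (u : Euc d → Euc d) (x : Euc d) : ℝ≥0 :=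
  if h : ∃ p : Euc d × Euc d × Sph d, IsJumpTriple u x p.1 p.2.1 p.2.2 then
    g (h.choose.1 - h.choose.2.1) h.choose.2.2
  else 0

open Classical in
/-- The functional `F^{f,g}(u, U)` for integrands `f`, `g` that do not depend on `x`. Here
`μHE[d - 1]` is the Hausdorff measure normalised so that it agrees with Lebesgue measure on
hyperplanes. -/
def energy {d : ℕ} (f : SymMat d → ℝ≥0) (g : Euc d → Sph d → ℝ≥0)
    (u : Euc d → Euc d) (U : Set (Euc d)) : ℝ≥0∞ :=
  if MemBDLoc U u then
    (∫⁻ x in U, (f (absContDensity U u x) : ℝ≥0∞))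
      + (∫⁻ x, recession f (polarDensity U u x) ∂(cantorVar U u))
      + ∫⁻ x in jumpSet U u, (surfaceDensity g u x : ℝ≥0∞) ∂μHE[d - 1]
  else ⊤

/-! The functional depends only on the class of `u` modulo equality almost everywhere on `U`, so
that it is well defined on `L¹(U; ℝᵈ)`. -/

theorem isSymGrad_congr {d : ℕ} {U : Set (Euc d)} {u v : Euc d → Euc d}
    (h : u =ᵐ[volume.restrict U] v) (lam : Measure (Euc d)) (s : Euc d → SymMat d) :
    IsSymGrad U u lam s ↔ IsSymGrad U v lam s := by
  have key : ∀ {u v : Euc d → Euc d}, u =ᵐ[volume.restrict U] v →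
      IsSymGrad U u lam s → IsSymGrad U v lam s := by
    intro u v h hu
    refine ⟨hu.1, hu.2, hu.3, hu.4, fun φ h1 h2 h3 i j => ?_⟩
    rw [← hu.5 φ h1 h2 h3 i j]
    refine integral_congr_ae ?_
    filter_upwards [h] with x hx
    rw [hx]
  exact ⟨key h, key h.symm⟩

theorem memBD_congr {d : ℕ} {U : Set (Euc d)} {u v : Euc d → Euc d}
    (h : u =ᵐ[volume.restrict U] v) : MemBD U u ↔ MemBD U v := by
  simp only [MemBD, isSymGrad_congr h]
  rw [integrableOn_congr_fun_ae h]

theorem memBDLoc_congr {d : ℕ} {U : Set (Euc d)} {u v : Euc d → Euc d}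
    (h : u =ᵐ[volume.restrict U] v) : MemBDLoc U u ↔ MemBDLoc U v := by
  refine and_congr (aestronglyMeasurable_congr h) ?_
  refine forall_congr' fun V => forall_congr' fun _ => forall_congr' fun _ =>
    forall_congr' fun hV => memBD_congr ?_
  exact ae_restrict_of_ae_restrict_of_subset (subset_closure.trans hV) h

theorem symGrad_congr {d : ℕ} {U : Set (Euc d)} {u v : Euc d → Euc d}
    (h : u =ᵐ[volume.restrict U] v) : symGrad U u = symGrad U v := by
  have e : (fun p : Measure (Euc d) × (Euc d → SymMat d) => IsSymGrad U u p.1 p.2)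
      = fun p => IsSymGrad U v p.1 p.2 := funext fun p => propext (isSymGrad_congr h p.1 p.2)
  exact congrArg (fun P : Measure (Euc d) × (Euc d → SymMat d) → Prop =>
    open Classical in if h : ∃ p, P p then h.choose else (0, fun _ => 0)) e

theorem isJumpTriple_congr {d : ℕ} {U : Set (Euc d)} (hU : IsOpen U) {u v : Euc d → Euc d}
    (h : u =ᵐ[volume.restrict U] v) {x : Euc d} (hx : x ∈ U) (a b : Euc d) (ν : Sph d) :
    IsJumpTriple u x a b ν ↔ IsJumpTriple v x a b ν := by
  obtain ⟨r, hr, hrU⟩ := Metric.isOpen_iff.1 hU x hx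
  have key : ∀ (S : Set (Euc d)) (c : Euc d),
      (fun ρ : ℝ => (∫⁻ y in Metric.ball x ρ ∩ S, ‖u y - c‖ₑ) / ENNReal.ofReal (ρ ^ d))
        =ᶠ[𝓝[>] 0]
      (fun ρ : ℝ => (∫⁻ y in Metric.ball x ρ ∩ S, ‖v y - c‖ₑ) / ENNReal.ofReal (ρ ^ d)) := by
    intro S c
    filter_upwards [Ioo_mem_nhdsGT hr] with ρ hρ
    congr 1
    refine lintegral_congr_ae ?_
    have hsub : Metric.ball x ρ ∩ S ⊆ U :=
      inter_subset_left.trans ((Metric.ball_subset_ball hρ.2.le).trans hrU)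
    filter_upwards [ae_restrict_of_ae_restrict_of_subset hsub h] with y hy
    rw [hy]
  exact and_congr Iff.rfl (and_congr (tendsto_congr' (key _ _)) (tendsto_congr' (key _ _)))

theorem jumpSet_congr {d : ℕ} {U : Set (Euc d)} (hU : IsOpen U) {u v : Euc d → Euc d}
    (h : u =ᵐ[volume.restrict U] v) : jumpSet U u = jumpSet U v := by
  ext x
  refine and_congr_right fun hx => ?_
  simp only [isJumpTriple_congr hU h hx]

theorem surfaceDensity_congr {d : ℕ} (g : Euc d → Sph d → ℝ≥0) {U : Set (Euc d)} (hU : IsOpen U)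
    {u v : Euc d → Euc d} (h : u =ᵐ[volume.restrict U] v) {x : Euc d} (hx : x ∈ U) :
    surfaceDensity g u x = surfaceDensity g v x := by
  have e : (fun p : Euc d × Euc d × Sph d => IsJumpTriple u x p.1 p.2.1 p.2.2)
      = fun p => IsJumpTriple v x p.1 p.2.1 p.2.2 :=
    funext fun p => propext (isJumpTriple_congr hU h hx p.1 p.2.1 p.2.2)
  exact congrArg (fun P : Euc d × Euc d × Sph d → Prop =>
    open Classical in if h : ∃ p, P p then g (h.choose.1 - h.choose.2.1) h.choose.2.2 else 0) e

theorem energy_congr {d : ℕ} (f : SymMat d → ℝ≥0) (g : Euc d → Sph d → ℝ≥0)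
    {U : Set (Euc d)} (hU : IsOpen U) {u v : Euc d → Euc d}
    (h : u =ᵐ[volume.restrict U] v) : energy f g u U = energy f g v U := by
  have hs := symGrad_congr h
  have hS : ∫⁻ x in jumpSet U u, (surfaceDensity g u x : ℝ≥0∞) ∂μHE[d - 1]
      = ∫⁻ x in jumpSet U v, (surfaceDensity g v x : ℝ≥0∞) ∂μHE[d - 1] := by
    rw [← jumpSet_congr hU h]
    have e : ∀ x ∈ U, (surfaceDensity g u x : ℝ≥0∞) = surfaceDensity g v x :=
      fun x hx => by rw [surfaceDensity_congr g hU h hx]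
    have h1 : ∀ w : Euc d → Euc d,
        ∫⁻ x in jumpSet U u, (surfaceDensity g w x : ℝ≥0∞) ∂μHE[d - 1]
          = ∫⁻ x in jumpSet U u, U.indicator (fun x => (surfaceDensity g w x : ℝ≥0∞)) x
              ∂μHE[d - 1] := by
      intro w
      refine lintegral_congr_ae ?_
      have : ∀ᵐ x ∂((μHE[d - 1] : Measure (Euc d)).restrict (jumpSet U u)), x ∈ U :=
        ae_mono (Measure.restrict_mono (fun x hx => hx.1) le_rfl)
          (ae_restrict_mem hU.measurableSet)
      filter_upwards [this] with x hx
      rw [indicator_of_mem hx]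
    rw [h1 u, h1 v, indicator_congr e]
  have hB := memBDLoc_congr h
  by_cases hv : MemBDLoc U v
  swap
  · rw [energy, energy, if_neg hv, if_neg (mt hB.1 hv)]
  rw [energy, energy, if_pos hv, if_pos (hB.2 hv), hS]
  simp only [absContDensity, cantorVar, totalVar, polarDensity, hs,
    jumpSet_congr hU h]

/-- `F^{f,g}(·, U)` is lower semicontinuous on `L¹(U; ℝᵈ)` with its norm topology. -/
def L1LowerSemicontinuous {d : ℕ} (f : SymMat d → ℝ≥0) (g : Euc d → Sph d → ℝ≥0)
    (U : Set (Euc d)) : Prop :=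
  LowerSemicontinuous fun u : Lp (Euc d) 1 (volume.restrict U) => energy f g u U

end BDEnergy

end

/-! Lower semicontinuity is tested only on functions of the single variable `⟨x, ν⟩`, namely
`profile ν ζ μ` for a finite measure `μ` on the line. Its symmetric gradient is `ζ ⊙ ν` times `plate
ν μ` (`isSymGrad_profile`), and neither test family below has a Cantor part. Two limits give the two
inequalities; write `A = ζ ⊙ ν` with `ζ ≠ 0`.

`g ≤ f^∞` (`surface_le_recession`): steeper and steeper ramps of total height `1` above level `s`
converge to a unit jump on the hyperplane at level `s`. For fixed `s` the volume of a thin strip of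
`U`, divided by its width, need not converge to the area of the slice, since `U` is an arbitrary
open set. Integrating in `s` removes this difficulty: by Fubini both quantities integrate to `|U|`,
and Fatou passes to the limit.

`f^∞ ≤ g` (`recession_le_surface`): a staircase with many small steps converges to an affine
function of slope `t`. By averaging over translations (`exists_sum_shift_le`), the jump hyperplanes
can be placed so that their total area in `U` is at most `|U|` over the spacing. Hence `f(tA) ≤ f(0)
+ t g(ζ, ν)`, and dividing by `t` gives the claim.

The energies are exact (`energy_ramp`, `energy_stair`). Since `energy` picks its polar form and its
jump triples by choice, this requires uniqueness of the former (`IsSymGrad.unique`) and uniqueness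
of the latter up to orientation (`isJumpTriple_iff_of_tendsto`). -/

noncomputable section

namespace BDEnergy

/-! ### Slicing by hyperplanes -/

/-- The hyperplane orthogonal to `ν`. -/
abbrev Hyp {d : ℕ} (ν : Sph d) : Type := ((Submodule.span ℝ {(ν : Euc d)})ᗮ : Submodule ℝ (Euc d))

lemma norm_sph {d : ℕ} (ν : Sph d) : ‖(ν : Euc d)‖ = 1 := by simp

lemma inner_sph_self {d : ℕ} (ν : Sph d) : inner ℝ (ν : Euc d) (ν : Euc d) = 1 := by
  rw [real_inner_self_eq_norm_sq, norm_sph, one_pow]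

lemma inner_hyp {d : ℕ} {ν : Sph d} (y : Hyp ν) : inner ℝ (y : Euc d) (ν : Euc d) = 0 := by
  rw [real_inner_comm]
  exact Submodule.mem_orthogonal_singleton_iff_inner_right.1 y.2

/-- The coordinates `(r, y) ↦ r ν + y` on `ℝᵈ`. -/
def sliceEquiv {d : ℕ} (ν : Sph d) : ℝ × Hyp ν ≃ᵐ Euc d :=
  ((LinearIsometryEquiv.toSpanUnitSingleton (𝕜 := ℝ) (ν : Euc d)
    (norm_sph ν)).toHomeomorph.toMeasurableEquiv.prodCongr (MeasurableEquiv.refl _)).trans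
    ((Submodule.span ℝ {(ν : Euc d)}).measurableEquivProd (0 : Euc d)).symm

lemma sliceEquiv_apply {d : ℕ} (ν : Sph d) (p : ℝ × Hyp ν) :
    sliceEquiv ν p = p.1 • (ν : Euc d) + p.2 := by
  rw [sliceEquiv, MeasurableEquiv.trans_apply, Submodule.measurableEquivProd_symm_apply,
    vadd_eq_add, add_zero]
  rfl

lemma measurePreserving_sliceEquiv {d : ℕ} (ν : Sph d) :
    MeasurePreserving (sliceEquiv ν) (volume.prod volume) volume := by
  have h1 := ((Submodule.span ℝ {(ν : Euc d)}).measurePreserving_measurableEquivProd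
    (0 : Euc d)).symm
  rw [InnerProductSpace.euclideanHausdorffMeasure_eq_volume] at h1
  have h2 : MeasurePreserving (LinearIsometryEquiv.toSpanUnitSingleton (𝕜 := ℝ) (ν : Euc d)
    (norm_sph ν)) := LinearIsometryEquiv.measurePreserving _
  exact (h2.prod (MeasurePreserving.id (volume : Measure (Hyp ν)))).trans h1

lemma inner_sliceEquiv {d : ℕ} (ν : Sph d) (p : ℝ × Hyp ν) :
    inner ℝ (sliceEquiv ν p) (ν : Euc d) = p.1 := by
  rw [sliceEquiv_apply, inner_add_left, inner_smul_left, inner_hyp, inner_sph_self]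
  simp

/-- The hyperplane `{x | ⟨x, ν⟩ = r}`. -/
def level {d : ℕ} (ν : Sph d) (r : ℝ) : Set (Euc d) := {x | inner ℝ x (ν : Euc d) = r}

lemma continuous_inner_sph {d : ℕ} (ν : Sph d) :
    Continuous fun x : Euc d => inner ℝ x (ν : Euc d) := by fun_prop

lemma measurable_inner_sph {d : ℕ} (ν : Sph d) :
    Measurable fun x : Euc d => inner ℝ x (ν : Euc d) := (continuous_inner_sph ν).measurable

lemma measurableSet_level {d : ℕ} (ν : Sph d) (r : ℝ) : MeasurableSet (level ν r) :=
  measurableSet_eq_fun (measurable_inner_sph ν) measurable_const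

lemma exists_sliceEquiv_eq {d : ℕ} {ν : Sph d} {r : ℝ} {x : Euc d} (hx : x ∈ level ν r) :
    ∃ y : Hyp ν, sliceEquiv ν (r, y) = x := by
  refine ⟨((sliceEquiv ν).symm x).2, ?_⟩
  have h := inner_sliceEquiv ν ((sliceEquiv ν).symm x)
  rw [MeasurableEquiv.apply_symm_apply, show inner ℝ x (ν : Euc d) = r from hx] at h
  rw [h]
  exact (sliceEquiv ν).apply_symm_apply x

lemma isometry_slice {d : ℕ} (ν : Sph d) (r : ℝ) :
    Isometry fun y : Hyp ν => sliceEquiv ν (r, y) := by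
  refine Isometry.of_dist_eq fun y z => ?_
  rw [sliceEquiv_apply, sliceEquiv_apply, dist_add_left, Subtype.dist_eq]

/-- The `(d - 1)`-dimensional measure of the slice `U ∩ {x | ⟨x, ν⟩ = r}`. -/
def sliceVol {d : ℕ} (ν : Sph d) (U : Set (Euc d)) (r : ℝ) : ℝ≥0∞ := μHE[d - 1] (U ∩ level ν r)

lemma finrank_hyp {d : ℕ} (ν : Sph d) : Module.finrank ℝ (Hyp ν) = d - 1 := by
  have hν : (ν : Euc d) ≠ 0 := norm_ne_zero_iff.1 (by rw [norm_sph]; exact one_ne_zero)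
  have h := (Submodule.span ℝ {(ν : Euc d)}).finrank_add_finrank_orthogonal
  rw [finrank_span_singleton hν, finrank_euclideanSpace_fin] at h
  exact Nat.eq_sub_of_add_eq' h

/-- Links the Hausdorff measure in the surface energy to the fibre measure of Fubini's theorem:
slices are isometric to subsets of `Hyp ν`, where the normalised Hausdorff measure is the volume. -/
lemma sliceVol_eq {d : ℕ} (ν : Sph d) (U : Set (Euc d)) (r : ℝ) :
    sliceVol ν U r = volume (Prod.mk r ⁻¹' (sliceEquiv ν ⁻¹' U)) := by
  have h1 : U ∩ level ν r
      = (fun y : Hyp ν => sliceEquiv ν (r, y)) '' (Prod.mk r ⁻¹' (sliceEquiv ν ⁻¹' U)) := by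
    ext x
    constructor
    · rintro ⟨hx, hr⟩
      obtain ⟨y, rfl⟩ := exists_sliceEquiv_eq hr
      exact ⟨y, hx, rfl⟩
    · rintro ⟨y, hy, rfl⟩
      exact ⟨hy, inner_sliceEquiv ν (r, y)⟩
  rw [sliceVol, h1, (isometry_slice ν r).euclideanHausdorffMeasure_image, ← finrank_hyp ν,
    InnerProductSpace.euclideanHausdorffMeasure_eq_volume]

lemma measurable_sliceVol {d : ℕ} (ν : Sph d) {U : Set (Euc d)} (hU : MeasurableSet U) :
    Measurable (sliceVol ν U) := by
  rw [funext (sliceVol_eq ν U)]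
  exact measurable_measure_prodMk_left ((sliceEquiv ν).measurable hU)

lemma lintegral_sliceVol {d : ℕ} (ν : Sph d) {U : Set (Euc d)} (hU : MeasurableSet U) :
    ∫⁻ r, sliceVol ν U r = volume U := by
  simp_rw [sliceVol_eq]
  rw [← Measure.prod_apply ((sliceEquiv ν).measurable hU),
    (measurePreserving_sliceEquiv ν).measure_preimage_equiv]

/-! ### Integration by parts on half spaces -/

lemma integrable_fderiv_apply {d : ℕ} {φ : Euc d → ℝ} (hφ : ContDiff ℝ ∞ φ)
    (hc : HasCompactSupport φ) (v : Euc d) : Integrable fun x => fderiv ℝ φ x v :=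
  (hφ.continuous_fderiv (by simp) |>.clm_apply continuous_const).integrable_of_hasCompactSupport
    ((hc.fderiv (𝕜 := ℝ)).mono' fun x hx => by
      refine subset_tsupport _ ?_
      intro h
      exact hx (by simp [h]))

/-- The indicator of the half space is constant along `w`, so its line derivative is `0` and
integration by parts leaves nothing. -/
lemma integral_halfspace_tangential {d : ℕ} {φ : Euc d → ℝ} (hφ : ContDiff ℝ ∞ φ)
    (hc : HasCompactSupport φ) (ν : Sph d) (r : ℝ) {w : Euc d}
    (hw : inner ℝ w (ν : Euc d) = 0) :
    ∫ x in {x : Euc d | r < inner ℝ x (ν : Euc d)}, fderiv ℝ φ x w = 0 := by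
  have hS : MeasurableSet {x : Euc d | r < inner ℝ x (ν : Euc d)} :=
    measurableSet_lt measurable_const (measurable_inner_sph ν)
  have hind : ∀ ψ : Euc d → ℝ, (fun x => ({x : Euc d | r < inner ℝ x (ν : Euc d)}.indicator
      (fun _ => (1 : ℝ)) x) * ψ x) = {x : Euc d | r < inner ℝ x (ν : Euc d)}.indicator ψ := by
    intro ψ
    ext x
    by_cases hx : r < inner ℝ x (ν : Euc d) <;> simp [indicator, hx]
  have key := integral_bilinear_hasLineDerivAt_right_eq_neg_left_of_integrable
    (μ := (volume : Measure (Euc d))) (B := ContinuousLinearMap.mul ℝ ℝ) (v := w)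
    (f := {x : Euc d | r < inner ℝ x (ν : Euc d)}.indicator fun _ => (1 : ℝ)) (f' := fun _ => 0)
    (g := φ) (g' := fun x => fderiv ℝ φ x w) (by simp)
    (by simpa only [ContinuousLinearMap.mul_apply', hind] using
      (integrable_fderiv_apply hφ hc w).indicator hS)
    (by simpa only [ContinuousLinearMap.mul_apply', hind] using
      (hφ.continuous.integrable_of_hasCompactSupport hc).indicator hS)
    (fun x _ => by
      have : (fun t : ℝ => {x : Euc d | r < inner ℝ x (ν : Euc d)}.indicator (fun _ => (1 : ℝ))
          (x + t • w)) = fun _ => {x : Euc d | r < inner ℝ x (ν : Euc d)}.indicator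
          (fun _ => (1 : ℝ)) x := by
        ext t
        simp [indicator, inner_add_left, inner_smul_left, hw]
      rw [HasLineDerivAt, this]
      exact hasDerivAt_const _ _)
    (fun x _ => ((hφ.differentiable (by simp)) x).hasFDerivAt.hasLineDerivAt w)
  simp only [ContinuousLinearMap.mul_apply', hind] at key
  rw [integral_indicator hS] at key
  simpa using key

/-- Fubini reduces this to the fundamental theorem of calculus on each line parallel to `ν`; compact
support removes the term at infinity. -/
lemma integral_halfspace_normal {d : ℕ} {φ : Euc d → ℝ} (hφ : ContDiff ℝ ∞ φ)
    (hc : HasCompactSupport φ) (ν : Sph d) (r : ℝ) :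
    ∫ x in {x : Euc d | r < inner ℝ x (ν : Euc d)}, fderiv ℝ φ x (ν : Euc d)
      = - ∫ y : Hyp ν, φ (sliceEquiv ν (r, y)) := by
  have hS : MeasurableSet {x : Euc d | r < inner ℝ x (ν : Euc d)} :=
    measurableSet_lt measurable_const (measurable_inner_sph ν)
  have hint := (integrable_fderiv_apply hφ hc (ν : Euc d)).indicator hS
  rw [← integral_indicator hS, ← (measurePreserving_sliceEquiv ν).integral_comp',
    integral_prod_symm (fun p => {x : Euc d | r < inner ℝ x (ν : Euc d)}.indicator
      (fun x => fderiv ℝ φ x (ν : Euc d)) (sliceEquiv ν p))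
      ((measurePreserving_sliceEquiv ν).integrable_comp_of_integrable hint),
    ← integral_neg]
  congr 1
  ext y
  have hline : ∀ t, HasDerivAt (fun t => φ (sliceEquiv ν (t, y)))
      (fderiv ℝ φ (sliceEquiv ν (t, y)) (ν : Euc d)) t := by
    intro t
    have h1 : HasDerivAt (fun t : ℝ => sliceEquiv ν (t, y)) (ν : Euc d) t := by
      simp only [sliceEquiv_apply]
      simpa using ((hasDerivAt_id t).smul_const (ν : Euc d)).add_const (y : Euc d)
    exact ((hφ.differentiable (by simp)) _).hasFDerivAt.comp_hasDerivAt t h1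
  have hiso : Isometry fun t : ℝ => sliceEquiv ν (t, y) := by
    refine Isometry.of_dist_eq fun a b => ?_
    simp only [sliceEquiv_apply]
    rw [dist_add_right, dist_eq_norm, ← sub_smul, norm_smul, norm_sph, mul_one, Real.dist_eq,
      Real.norm_eq_abs]
  have hψc : HasCompactSupport fun t : ℝ => φ (sliceEquiv ν (t, y)) :=
    hc.comp_isClosedEmbedding hiso.isClosedEmbedding
  have hψ : ContDiff ℝ 1 fun t : ℝ => φ (sliceEquiv ν (t, y)) := by
    simp only [sliceEquiv_apply]
    exact (hφ.of_le (by simp)).comp (by fun_prop)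
  rw [← hψc.integral_Ioi_deriv_eq hψ r, ← integral_indicator measurableSet_Ioi]
  congr 1
  ext t
  by_cases ht : r < t
  · rw [indicator_of_mem (by simpa [inner_sliceEquiv] using ht), indicator_of_mem (by exact ht),
      (hline t).deriv]
  · rw [indicator_of_notMem (by simpa [inner_sliceEquiv] using ht),
      indicator_of_notMem (by exact ht)]

lemma integral_halfspace {d : ℕ} {φ : Euc d → ℝ} (hφ : ContDiff ℝ ∞ φ)
    (hc : HasCompactSupport φ) (ν : Sph d) (r : ℝ) (v : Euc d) :
    ∫ x in {x : Euc d | r < inner ℝ x (ν : Euc d)}, fderiv ℝ φ x v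
      = - (inner ℝ v (ν : Euc d) * ∫ y : Hyp ν, φ (sliceEquiv ν (r, y))) := by
  have hv : v = inner ℝ v (ν : Euc d) • (ν : Euc d) + (v - inner ℝ v (ν : Euc d) • (ν : Euc d)) :=
    by abel
  have hw : inner ℝ (v - inner ℝ v (ν : Euc d) • (ν : Euc d)) (ν : Euc d) = 0 := by
    rw [inner_sub_left, inner_smul_left, inner_sph_self]
    simp
  have h : ∀ x, fderiv ℝ φ x v = inner ℝ v (ν : Euc d) * fderiv ℝ φ x (ν : Euc d)
      + fderiv ℝ φ x (v - inner ℝ v (ν : Euc d) • (ν : Euc d)) := by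
    intro x
    conv_lhs => rw [hv]
    rw [map_add, map_smul, smul_eq_mul]
  simp_rw [h]
  rw [integral_add ((integrable_fderiv_apply hφ hc _).integrableOn.const_mul _)
    (integrable_fderiv_apply hφ hc _).integrableOn, integral_const_mul,
    integral_halfspace_normal hφ hc, integral_halfspace_tangential hφ hc ν r hw]
  ring

/-! ### The Frobenius norm -/

lemma frob_nonneg {d : ℕ} (A : SymMat d) : 0 ≤ frob A := Real.sqrt_nonneg _

lemma frob_smul {d : ℕ} (c : ℝ) (A : SymMat d) : frob (c • A) = |c| * frob A := by
  have h : ∑ i, ∑ j, ((c • A).1 i j) ^ 2 = c ^ 2 * ∑ i, ∑ j, (A.1 i j) ^ 2 := by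
    simp [Finset.mul_sum, mul_pow]
  rw [frob, h, Real.sqrt_mul (sq_nonneg c), Real.sqrt_sq_eq_abs, frob]

lemma frob_eq_zero_iff {d : ℕ} {A : SymMat d} : frob A = 0 ↔ A = 0 := by
  constructor
  · intro h
    rw [frob, Real.sqrt_eq_zero (by positivity)] at h
    ext i j
    have h1 := (Finset.sum_eq_zero_iff_of_nonneg (fun i _ => by positivity)).1 h i
      (Finset.mem_univ i)
    have h2 := (Finset.sum_eq_zero_iff_of_nonneg (fun j _ => by positivity)).1 h1 j
      (Finset.mem_univ j)
    simpa using h2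
  · rintro rfl
    simp [frob]

lemma frob_pos {d : ℕ} {A : SymMat d} (hA : A ≠ 0) : 0 < frob A :=
  (frob_nonneg A).lt_of_ne fun h => hA (frob_eq_zero_iff.1 h.symm)

lemma symTensor_zero_left {d : ℕ} (b : Euc d) : symTensor 0 b = 0 := by
  ext i j
  simp [symTensor]

lemma inner_eq_sum {d : ℕ} (x y : Euc d) : inner ℝ x y = ∑ i, x i * y i := by
  simp [PiLp.inner_apply, mul_comm]

/-- If `ζ ⊙ ν = 0`, contraction with `ν` gives `ζ + ⟨ζ, ν⟩ ν = 0`; pairing this with `ν` once more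
gives `⟨ζ, ν⟩ = 0`, hence `ζ = 0`. -/
lemma symTensor_ne_zero {d : ℕ} {ζ : Euc d} (hζ : ζ ≠ 0) (ν : Sph d) :
    symTensor ζ (ν : Euc d) ≠ 0 := by
  intro h
  have hij : ∀ i j, ζ i * (ν : Euc d) j + ζ j * (ν : Euc d) i = 0 := by
    intro i j
    have := congrFun (congrFun (congrArg Subtype.val h) i) j
    simp only [symTensor, Matrix.of_apply, ZeroMemClass.coe_zero, Matrix.zero_apply] at this
    linarith
  have h1 : ∀ i, ζ i + inner ℝ ζ (ν : Euc d) * (ν : Euc d) i = 0 := by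
    intro i
    have h2 : ∑ j, (ζ i * (ν : Euc d) j + ζ j * (ν : Euc d) i) * (ν : Euc d) j = 0 :=
      Finset.sum_eq_zero fun j _ => by rw [hij, zero_mul]
    have h3 : ∑ j, (ζ i * (ν : Euc d) j + ζ j * (ν : Euc d) i) * (ν : Euc d) j
        = ζ i * inner ℝ (ν : Euc d) (ν : Euc d) + inner ℝ ζ (ν : Euc d) * (ν : Euc d) i := by
      rw [inner_eq_sum, inner_eq_sum, Finset.mul_sum, Finset.sum_mul, ← Finset.sum_add_distrib]
      exact Finset.sum_congr rfl fun j _ => by ring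
    rw [h3, inner_sph_self, mul_one] at h2
    exact h2
  have h4 : ζ + inner ℝ ζ (ν : Euc d) • (ν : Euc d) = 0 := by
    ext i
    simpa using h1 i
  have h5 : inner ℝ ζ (ν : Euc d) = 0 := by
    have := congrArg (fun z => inner ℝ z (ν : Euc d)) h4
    simp only [inner_add_left, inner_smul_left, inner_sph_self, inner_zero_left] at this
    simp only [conj_trivial] at this
    linarith
  rw [h5, zero_smul, add_zero] at h4
  exact hζ h4

/-! ### Functions of one variable `⟨x, ν⟩` -/

/-- The function `x ↦ μ((-∞, ⟨x, ν⟩)) ζ`, whose gradient is `ζ ⊗ ν` times `plate ν μ`. -/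
def profile {d : ℕ} (ν : Sph d) (ζ : Euc d) (μ : Measure ℝ) (x : Euc d) : Euc d :=
  μ.real (Iio (inner ℝ x (ν : Euc d))) • ζ

/-- The product of `μ` and Lebesgue measure, in the coordinates `(r, y) ↦ r ν + y`. -/
def plate {d : ℕ} (ν : Sph d) (μ : Measure ℝ) : Measure (Euc d) :=
  (μ.prod volume).map (sliceEquiv ν)

lemma plate_lt_top_of_isBounded {d : ℕ} (ν : Sph d) (μ : Measure ℝ) [IsFiniteMeasure μ]
    {K : Set (Euc d)} (hK : Bornology.IsBounded K) : plate ν μ K < ⊤ := by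
  obtain ⟨R, hR⟩ := hK.subset_closedBall 0
  refine (measure_mono hR).trans_lt ?_
  rw [plate, MeasurableEquiv.map_apply]
  have hsub : sliceEquiv ν ⁻¹' Metric.closedBall 0 R ⊆ univ ×ˢ Metric.closedBall 0 R := by
    rintro ⟨r, y⟩ h
    refine ⟨trivial, ?_⟩
    rw [mem_preimage, mem_closedBall_zero_iff, sliceEquiv_apply] at h
    rw [mem_closedBall_zero_iff]
    refine le_trans ?_ h
    have h2 : inner ℝ (r • (ν : Euc d)) (y : Euc d) = 0 := by
      rw [inner_smul_left, real_inner_comm, inner_hyp, mul_zero]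
    have h1 := norm_add_sq_eq_norm_sq_add_norm_sq_real h2
    have : ‖y‖ = ‖(y : Euc d)‖ := rfl
    rw [this]
    exact abs_le_of_sq_le_sq' (by nlinarith [norm_nonneg (r • (ν : Euc d))]) (norm_nonneg _) |>.2
  refine (measure_mono hsub).trans_lt ?_
  rw [Measure.prod_prod]
  exact ENNReal.mul_lt_top (measure_lt_top _ _) measure_closedBall_lt_top

instance {d : ℕ} (ν : Sph d) (μ : Measure ℝ) [IsFiniteMeasure μ] :
    IsFiniteMeasureOnCompacts (plate ν μ) :=
  ⟨fun _ hK => plate_lt_top_of_isBounded ν μ hK.isBounded⟩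

lemma measurable_real_Iio (μ : Measure ℝ) [IsFiniteMeasure μ] :
    Measurable fun t => μ.real (Iio t) :=
  Monotone.measurable fun _ _ h => measureReal_mono (Iio_subset_Iio h)

lemma measurable_profile {d : ℕ} (ν : Sph d) (ζ : Euc d) (μ : Measure ℝ) [IsFiniteMeasure μ] :
    Measurable (profile ν ζ μ) :=
  ((measurable_real_Iio μ).comp (measurable_inner_sph ν)).smul_const ζ

lemma norm_profile_le {d : ℕ} (ν : Sph d) (ζ : Euc d) (μ : Measure ℝ) [IsFiniteMeasure μ]
    (x : Euc d) : ‖profile ν ζ μ x‖ ≤ μ.real univ * ‖ζ‖ := by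
  rw [profile, norm_smul, Real.norm_of_nonneg measureReal_nonneg]
  exact mul_le_mul_of_nonneg_right (measureReal_mono (subset_univ _)) (norm_nonneg ζ)

lemma integrableOn_profile {d : ℕ} (ν : Sph d) (ζ : Euc d) (μ : Measure ℝ) [IsFiniteMeasure μ]
    {U : Set (Euc d)} (hU : volume U < ⊤) : IntegrableOn (profile ν ζ μ) U :=
  Measure.integrableOn_of_bounded hU.ne (measurable_profile ν ζ μ).aestronglyMeasurable
    (Eventually.of_forall fun x => norm_profile_le ν ζ μ x)

/-- Layer cake: `μ (Iio t)` is the `μ`-integral over `r` of the indicator of `r < t`, so after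
exchanging integrals the formula is a superposition of half space formulas. -/
lemma integral_real_Iio_mul_fderiv {d : ℕ} {φ : Euc d → ℝ} (hφ : ContDiff ℝ ∞ φ)
    (hc : HasCompactSupport φ) (ν : Sph d) (μ : Measure ℝ) [IsFiniteMeasure μ] (v : Euc d) :
    ∫ x, μ.real (Iio (inner ℝ x (ν : Euc d))) * fderiv ℝ φ x v
      = - (inner ℝ v (ν : Euc d) * ∫ x, φ x ∂(plate ν μ)) := by
  have h1 : ∀ x : Euc d, μ.real (Iio (inner ℝ x (ν : Euc d))) * fderiv ℝ φ x v
      = ∫ r, {p : Euc d × ℝ | p.2 < inner ℝ p.1 (ν : Euc d)}.indicator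
          (fun p => fderiv ℝ φ p.1 v) (x, r) ∂μ := by
    intro x
    have : (fun r => {p : Euc d × ℝ | p.2 < inner ℝ p.1 (ν : Euc d)}.indicator
        (fun p => fderiv ℝ φ p.1 v) (x, r))
        = (Iio (inner ℝ x (ν : Euc d))).indicator fun _ => fderiv ℝ φ x v := by
      ext r
      simp [indicator]
    rw [this, integral_indicator measurableSet_Iio, setIntegral_const, smul_eq_mul]
  have hS : MeasurableSet {p : Euc d × ℝ | p.2 < inner ℝ p.1 (ν : Euc d)} :=
    measurableSet_lt measurable_snd ((measurable_inner_sph ν).comp measurable_fst)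
  simp_rw [h1]
  rw [integral_integral_swap (f := fun x r => {p : Euc d × ℝ | p.2 < inner ℝ p.1 (ν : Euc d)}.indicator
          (fun p => fderiv ℝ φ p.1 v) (x, r))
      (((integrable_fderiv_apply hφ hc v).comp_fst μ).indicator hS)]
  have h2 : ∀ r, ∫ x, {p : Euc d × ℝ | p.2 < inner ℝ p.1 (ν : Euc d)}.indicator
          (fun p => fderiv ℝ φ p.1 v) (x, r)
        = - (inner ℝ v (ν : Euc d) * ∫ y : Hyp ν, φ (sliceEquiv ν (r, y))) := by
    intro r
    rw [← integral_halfspace hφ hc, ← integral_indicator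
      (measurableSet_lt measurable_const (measurable_inner_sph ν))]
    rfl
  simp_rw [h2]
  rw [integral_neg, integral_const_mul, plate, integral_map_equiv, integral_prod
    (fun p => φ (sliceEquiv ν p))]
  have : Integrable φ (plate ν μ) := hφ.continuous.integrable_of_hasCompactSupport hc
  exact (integrable_map_equiv _ _).1 this

/-- The total variation of the symmetric gradient of `profile ν ζ μ` on `U`. -/
def profileVar {d : ℕ} (ν : Sph d) (ζ : Euc d) (μ : Measure ℝ) (U : Set (Euc d)) :
    Measure (Euc d) :=
  ENNReal.ofReal (frob (symTensor ζ (ν : Euc d))) • (plate ν μ).restrict U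

lemma isSymGrad_profile {d : ℕ} (ν : Sph d) {ζ : Euc d} (hζ : ζ ≠ 0) (μ : Measure ℝ)
    [IsFiniteMeasure μ] {U : Set (Euc d)} (hU : MeasurableSet U) :
    IsSymGrad U (profile ν ζ μ) (profileVar ν ζ μ U)
      (fun _ => (frob (symTensor ζ (ν : Euc d)))⁻¹ • symTensor ζ (ν : Euc d)) := by
  have hA := frob_pos (symTensor_ne_zero hζ ν)
  refine ⟨?_, ?_, measurable_const, ?_, ?_⟩
  · simp [profileVar, Measure.restrict_apply hU.compl]
  · intro K hK _
    rw [profileVar, Measure.smul_apply, smul_eq_mul]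
    exact ENNReal.mul_lt_top ENNReal.ofReal_lt_top
      ((Measure.restrict_le_self K).trans_lt hK.measure_lt_top)
  · refine Eventually.of_forall fun x => ?_
    rw [frob_smul, abs_of_pos (by positivity), inv_mul_cancel₀ hA.ne']
  · intro φ hφ hc hsub i j
    have hz : ∀ x, x ∉ U → φ x = 0 := fun x hx =>
      image_eq_zero_of_notMem_tsupport fun h => hx (hsub h)
    have hz' : ∀ x, x ∉ U → fderiv ℝ φ x = 0 := fun x hx =>
      image_eq_zero_of_notMem_tsupport fun h => hx (hsub (tsupport_fderiv_subset ℝ h))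
    have hint : ∀ v, Integrable fun x => μ.real (Iio (inner ℝ x (ν : Euc d))) * fderiv ℝ φ x v := by
      intro v
      refine (integrable_fderiv_apply hφ hc v).bdd_mul (c := μ.real univ)
        ((measurable_real_Iio μ).comp (measurable_inner_sph ν)).aestronglyMeasurable
        (Eventually.of_forall fun x => ?_)
      rw [Real.norm_of_nonneg measureReal_nonneg]
      exact measureReal_mono (subset_univ _)
    rw [setIntegral_eq_integral_of_forall_compl_eq_zero (fun x hx => by simp [hz' x hx])]
    have h1 : ∀ x, (profile ν ζ μ x i * fderiv ℝ φ x (EuclideanSpace.single j 1)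
          + profile ν ζ μ x j * fderiv ℝ φ x (EuclideanSpace.single i 1)) / 2
        = ζ i / 2 * (μ.real (Iio (inner ℝ x (ν : Euc d)))
            * fderiv ℝ φ x (EuclideanSpace.single j 1))
          + ζ j / 2 * (μ.real (Iio (inner ℝ x (ν : Euc d)))
            * fderiv ℝ φ x (EuclideanSpace.single i 1)) := by
      intro x
      simp only [profile, PiLp.smul_apply, smul_eq_mul]
      ring
    simp_rw [h1]
    rw [integral_add ((hint _).const_mul _) ((hint _).const_mul _), integral_const_mul,
      integral_const_mul, integral_real_Iio_mul_fderiv hφ hc, integral_real_Iio_mul_fderiv hφ hc,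
      profileVar, integral_smul_measure, ENNReal.toReal_ofReal hA.le, integral_mul_const,
      setIntegral_eq_integral_of_forall_compl_eq_zero (fun x hx => hz x hx)]
    simp only [EuclideanSpace.inner_single_left, symTensor, Submodule.coe_smul, Matrix.smul_apply,
      Matrix.of_apply, smul_eq_mul, map_one]
    rw [symTensor] at hA
    field_simp
    ring

lemma memBD_profile {d : ℕ} (ν : Sph d) {ζ : Euc d} (hζ : ζ ≠ 0) (μ : Measure ℝ)
    [IsFiniteMeasure μ] {U : Set (Euc d)} (hU : IsOpen U) (hb : Bornology.IsBounded U) :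
    MemBD U (profile ν ζ μ) := by
  refine ⟨integrableOn_profile ν ζ μ hb.measure_lt_top, _, _,
    isSymGrad_profile ν hζ μ hU.measurableSet, ?_⟩
  rw [profileVar, Measure.smul_apply, smul_eq_mul]
  exact ENNReal.mul_lt_top ENNReal.ofReal_lt_top
    ((Measure.restrict_le_self U).trans_lt (plate_lt_top_of_isBounded ν μ hb))

lemma memBDLoc_profile {d : ℕ} (ν : Sph d) {ζ : Euc d} (hζ : ζ ≠ 0) (μ : Measure ℝ)
    [IsFiniteMeasure μ] (U : Set (Euc d)) : MemBDLoc U (profile ν ζ μ) :=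
  ⟨(measurable_profile ν ζ μ).aestronglyMeasurable, fun _ hV hc _ =>
    memBD_profile ν hζ μ hV (hc.isBounded.subset subset_closure)⟩

/-! ### Uniqueness of the polar form -/

/-- An exhaustion of `U` by compact sets, each enlarged by the null set `Uᶜ` so that the union is
the whole space. -/
lemma IsSymGrad.sigmaFinite {d : ℕ} {U : Set (Euc d)} (hU : IsOpen U) {u : Euc d → Euc d}
    {lam : Measure (Euc d)} {s : Euc d → SymMat d} (h : IsSymGrad U u lam s) :
    SigmaFinite lam := by
  have : LocallyCompactSpace U := hU.locallyCompactSpace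
  refine ⟨⟨⟨fun n => Subtype.val '' compactCovering U n ∪ Uᶜ, fun _ => trivial, fun n => ?_, ?_⟩⟩⟩
  · refine (measure_union_le _ _).trans_lt ?_
    rw [h.compl_eq_zero, add_zero]
    exact h.finite_on_compacts _ ((isCompact_compactCovering U n).image continuous_subtype_val)
      (by rintro _ ⟨x, _, rfl⟩; exact x.2)
  · refine eq_univ_of_forall fun x => ?_
    by_cases hx : x ∈ U
    · obtain ⟨n, hn⟩ := exists_mem_compactCovering (⟨x, hx⟩ : U)
      exact mem_iUnion.2 ⟨n, Or.inl ⟨_, hn, rfl⟩⟩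
    · exact mem_iUnion.2 ⟨0, Or.inr hx⟩

lemma abs_entry_le_frob {d : ℕ} (A : SymMat d) (i j : Fin d) : |A.1 i j| ≤ frob A := by
  refine Real.abs_le_sqrt ?_
  calc (A.1 i j) ^ 2 ≤ ∑ j, (A.1 i j) ^ 2 :=
        Finset.single_le_sum (f := fun j => (A.1 i j) ^ 2) (fun _ _ => sq_nonneg _)
          (Finset.mem_univ j)
    _ ≤ ∑ i, ∑ j, (A.1 i j) ^ 2 :=
        Finset.single_le_sum (f := fun i => ∑ j, (A.1 i j) ^ 2)
          (fun _ _ => Finset.sum_nonneg fun _ _ => sq_nonneg _) (Finset.mem_univ i)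

lemma measurable_entry {d : ℕ} (i j : Fin d) : Measurable fun A : SymMat d => A.1 i j :=
  ((continuous_subtype_val (p := (· ∈ symSubmodule d))).matrix_elem i j).measurable

lemma IsSymGrad.integrableOn_entry {d : ℕ} {U : Set (Euc d)} {u : Euc d → Euc d}
    {lam : Measure (Euc d)} {s : Euc d → SymMat d} (h : IsSymGrad U u lam s)
    {K : Set (Euc d)} (hK : IsCompact K) (hKU : K ⊆ U) (i j : Fin d) :
    IntegrableOn (fun x => (s x).1 i j) K lam := by
  refine Measure.integrableOn_of_bounded (M := 1) (h.finite_on_compacts K hK hKU).ne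
    ((measurable_entry i j).comp h.measurable_density).aestronglyMeasurable
    (ae_restrict_of_ae ?_)
  filter_upwards [h.norm_density] with x hx
  exact hx ▸ abs_entry_le_frob (s x) i j

lemma IsSymGrad.locallyIntegrableOn_rnDeriv {d : ℕ} {U : Set (Euc d)} (hU : IsOpen U)
    {u : Euc d → Euc d} {lam m : Measure (Euc d)} {s : Euc d → SymMat d} (h : IsSymGrad U u lam s)
    [SigmaFinite m] (hm : lam ≪ m) (i j : Fin d) :
    LocallyIntegrableOn (fun x => (lam.rnDeriv m x).toReal • (s x).1 i j) U m := by
  have := h.sigmaFinite hU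
  refine (locallyIntegrableOn_iff hU.isLocallyClosed).2 fun K hKU hK => ?_
  have h1 := (integrable_indicator_iff hK.measurableSet).2 (h.integrableOn_entry hK hKU i j)
  rw [← integrable_indicator_iff hK.measurableSet]
  refine ((integrable_rnDeriv_smul_iff hm).2 h1).congr (Eventually.of_forall fun x => ?_)
  by_cases hx : x ∈ K <;> simp [hx]

/-- Both measures are differentiated with respect to their sum. Test functions identify the products
of density and direction; since the directions have norm `1`, the Frobenius norm recovers the
densities, and then the directions agree where the density is positive. -/
lemma IsSymGrad.unique {d : ℕ} {U : Set (Euc d)} (hU : IsOpen U) {u : Euc d → Euc d}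
    {lam lam' : Measure (Euc d)} {s s' : Euc d → SymMat d} (h : IsSymGrad U u lam s)
    (h' : IsSymGrad U u lam' s') : lam = lam' ∧ s =ᵐ[lam] s' := by
  have := h.sigmaFinite hU
  have := h'.sigmaFinite hU
  set m := lam + lam' with hm
  have hac : lam ≪ m := Measure.absolutelyContinuous_of_le (Measure.le_add_right le_rfl)
  have hac' : lam' ≪ m := Measure.absolutelyContinuous_of_le (Measure.le_add_left le_rfl)
  have hentry : ∀ i j, ∀ᵐ x ∂m, x ∈ U →
      (lam.rnDeriv m x).toReal • (s x).1 i j - (lam'.rnDeriv m x).toReal • (s' x).1 i j = 0 := by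
    intro i j
    have hl := h.locallyIntegrableOn_rnDeriv hU hac i j
    have hl' := h'.locallyIntegrableOn_rnDeriv hU hac' i j
    refine hU.ae_eq_zero_of_integral_contDiff_smul_eq_zero (hl.sub hl') fun φ hφ hc hs => ?_
    have e := neg_injective ((h.weak_eq φ hφ hc hs i j).symm.trans (h'.weak_eq φ hφ hc hs i j))
    have hint : ∀ {ρ : Measure (Euc d)} {σ : Euc d → SymMat d}, IsSymGrad U u ρ σ →
        Integrable (fun x => φ x * (σ x).1 i j) ρ := by
      intro ρ σ hρ
      have hK : IsCompact (tsupport φ) := hc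
      have h1 : IntegrableOn (fun x => φ x * (σ x).1 i j) (tsupport φ) ρ :=
        (hρ.integrableOn_entry hK hs i j).continuousOn_mul hφ.continuous.continuousOn hK
      refine (integrableOn_iff_integrable_of_support_subset ?_).1 h1
      intro x hx
      exact subset_tsupport φ (left_ne_zero_of_mul hx)
    have h1 := hint h
    have h1' := hint h'
    rw [← integral_rnDeriv_smul hac, ← integral_rnDeriv_smul hac'] at e
    have h2 := (integrable_rnDeriv_smul_iff hac).2 h1
    have h2' := (integrable_rnDeriv_smul_iff hac').2 h1'
    rw [← sub_eq_zero, ← integral_sub h2 h2'] at e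
    rw [← e]
    congr 1
    ext x
    simp only [smul_eq_mul]
    ring
  have hw := Measure.withDensity_rnDeriv_eq lam m hac
  have hw' := Measure.withDensity_rnDeriv_eq lam' m hac'
  have hn := h.norm_density
  rw [← hw, ae_withDensity_iff (Measure.measurable_rnDeriv _ _)] at hn
  have hn' := h'.norm_density
  rw [← hw', ae_withDensity_iff (Measure.measurable_rnDeriv _ _)] at hn'
  have hmU : ∀ᵐ x ∂m, x ∈ U := by
    rw [ae_iff, hm]
    simpa using ⟨h.compl_eq_zero, h'.compl_eq_zero⟩
  have hsm : ∀ᵐ x ∂m, (lam.rnDeriv m x).toReal • s x = (lam'.rnDeriv m x).toReal • s' x := by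
    filter_upwards [hmU, ae_all_iff.2 fun i => ae_all_iff.2 fun j => hentry i j] with x hx hx'
    ext i j
    exact sub_eq_zero.1 (hx' i j hx)
  -- Where the density `a` vanishes nothing is known about `B`, but then the product is `0` anyway.
  have hscal : ∀ (a : ℝ≥0∞) (B : SymMat d), (a ≠ 0 → frob B = 1) →
      frob (a.toReal • B) = a.toReal := by
    intro a B hB
    rw [frob_smul, abs_of_nonneg ENNReal.toReal_nonneg]
    rcases eq_or_ne a 0 with rfl | ha
    · simp
    · rw [hB ha, mul_one]
  have hden : ∀ᵐ x ∂m, lam.rnDeriv m x = lam'.rnDeriv m x := by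
    filter_upwards [hsm, hn, hn', lam.rnDeriv_lt_top m, lam'.rnDeriv_lt_top m] with x h1 h2 h3 h4 h5
    have := congrArg frob h1
    rw [hscal _ _ h2, hscal _ _ h3] at this
    exact (ENNReal.toReal_eq_toReal_iff' h4.ne h5.ne).1 this
  refine ⟨by rw [← hw, ← hw']; exact withDensity_congr_ae hden, ?_⟩
  have : ∀ᵐ x ∂(m.withDensity (lam.rnDeriv m)), s x = s' x := by
    rw [ae_withDensity_iff (Measure.measurable_rnDeriv _ _)]
    filter_upwards [hsm, hden, lam.rnDeriv_lt_top m] with x h1 h2 h3 h4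
    rw [← h2] at h1
    exact smul_right_injective _ (ENNReal.toReal_pos h4 h3.ne).ne' h1
  rwa [hw] at this

lemma IsSymGrad.totalVar_eq {d : ℕ} {U : Set (Euc d)} (hU : IsOpen U) {u : Euc d → Euc d}
    {lam : Measure (Euc d)} {s : Euc d → SymMat d} (h : IsSymGrad U u lam s) :
    totalVar U u = lam ∧ s =ᵐ[lam] polarDensity U u := by
  have hex : ∃ p : Measure (Euc d) × (Euc d → SymMat d), IsSymGrad U u p.1 p.2 := ⟨(lam, s), h⟩
  have hsg : symGrad U u = hex.choose := dif_pos hex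
  have hc : IsSymGrad U u (totalVar U u) (polarDensity U u) := by
    rw [totalVar, polarDensity, hsg]
    exact hex.choose_spec
  have := h.unique hU hc
  exact ⟨this.1.symm, this.2⟩

/-! ### One-sided limits and jumps -/

lemma tendsto_real_Iio_nhdsGT (μ : Measure ℝ) [IsFiniteMeasure μ] (t : ℝ) :
    Tendsto (fun r => μ.real (Iio r)) (𝓝[>] t) (𝓝 (μ.real (Iic t))) := by
  refine (ENNReal.tendsto_toReal (measure_ne_top _ _)).comp
    (tendsto_measure_of_tendsto_indicator_of_isFiniteMeasure _ μ
      (fun _ => measurableSet_Iio) fun x => ?_)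
  by_cases hx : x ≤ t
  · filter_upwards [self_mem_nhdsWithin] with r hr
    simp only [mem_Iio, mem_Iic, hx, iff_true]
    exact hx.trans_lt hr
  · filter_upwards [Ioo_mem_nhdsGT (not_le.1 hx)] with r hr
    simp only [mem_Iio, mem_Iic, hx, iff_false, not_lt]
    exact hr.2.le

lemma tendsto_real_Iio_nhdsLT (μ : Measure ℝ) [IsFiniteMeasure μ] (t : ℝ) :
    Tendsto (fun r => μ.real (Iio r)) (𝓝[<] t) (𝓝 (μ.real (Iio t))) := by
  refine (ENNReal.tendsto_toReal (measure_ne_top _ _)).comp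
    (tendsto_measure_of_tendsto_indicator_of_isFiniteMeasure _ μ
      (fun _ => measurableSet_Iio) fun x => ?_)
  by_cases hx : x < t
  · filter_upwards [Ioo_mem_nhdsLT hx] with r hr
    simp only [mem_Iio, hx, iff_true]
    exact hr.1
  · filter_upwards [self_mem_nhdsWithin] with r hr
    simp only [mem_Iio, hx, iff_false, not_lt]
    exact (show r < t from hr).le.trans (not_lt.1 hx)

/-- The open half space bounded by the hyperplane through `x` with inner normal `w`. -/
def halfSpace {d : ℕ} (x w : Euc d) : Set (Euc d) := {y | 0 < inner ℝ (y - x) w}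

lemma setOf_inner_neg_eq {d : ℕ} (x w : Euc d) :
    {y : Euc d | inner ℝ (y - x) w < 0} = halfSpace x (-w) := by
  ext y
  simp [halfSpace, inner_neg_right]

/-- `a` is the limit in the mean of `u` at `x`, in the half space with inner normal `w`. -/
def IsMeanLimit {d : ℕ} (u : Euc d → Euc d) (x w a : Euc d) : Prop :=
  Tendsto (fun ρ : ℝ => (∫⁻ y in Metric.ball x ρ ∩ halfSpace x w, ‖u y - a‖ₑ)
    / ENNReal.ofReal (ρ ^ d)) (𝓝[>] 0) (𝓝 0)

lemma isJumpTriple_iff {d : ℕ} {u : Euc d → Euc d} {x a b : Euc d} {ν : Sph d} :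
    IsJumpTriple u x a b ν ↔
      a ≠ b ∧ IsMeanLimit u x (ν : Euc d) a ∧ IsMeanLimit u x (-(ν : Euc d)) b := by
  rw [IsJumpTriple, setOf_inner_neg_eq]
  rfl

lemma isMeanLimit_of_tendsto {d : ℕ} {u : Euc d → Euc d} {x w a : Euc d}
    (h : Tendsto u (𝓝[halfSpace x w] x) (𝓝 a)) : IsMeanLimit u x w a := by
  rw [IsMeanLimit, ENNReal.tendsto_nhds_zero]
  intro ε hε
  have hB : volume (Metric.ball (0 : Euc d) 1) ≠ ⊤ := measure_ball_lt_top.ne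
  have hB0 : volume (Metric.ball (0 : Euc d) 1) ≠ 0 :=
    (Metric.measure_ball_pos volume _ one_pos).ne'
  obtain ⟨δ, hδ, hδε⟩ : ∃ δ : ℝ≥0∞, 0 < δ ∧ δ * volume (Metric.ball (0 : Euc d) 1) ≤ ε := by
    refine ⟨ε / volume (Metric.ball (0 : Euc d) 1), ENNReal.div_pos hε.ne' hB, ?_⟩
    rw [ENNReal.div_mul_cancel hB0 hB]
  have h1 := (tendsto_iff_edist_tendsto_0.1 h).eventually (ge_mem_nhds hδ)
  obtain ⟨r, hr, hr'⟩ := Metric.mem_nhdsWithin_iff.1 h1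
  filter_upwards [Ioo_mem_nhdsGT hr] with ρ hρ
  refine ENNReal.div_le_of_le_mul ?_
  calc ∫⁻ y in Metric.ball x ρ ∩ halfSpace x w, ‖u y - a‖ₑ
      ≤ ∫⁻ y in Metric.ball x ρ ∩ halfSpace x w, δ := by
        refine setLIntegral_mono measurable_const fun y hy => ?_
        have := hr' ⟨Metric.ball_subset_ball hρ.2.le hy.1, hy.2⟩
        rwa [mem_ofPred_eq, edist_eq_enorm_sub] at this
    _ = δ * volume (Metric.ball x ρ ∩ halfSpace x w) := by rw [setLIntegral_const]
    _ ≤ δ * volume (Metric.ball x ρ) := by gcongr; exact inter_subset_left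
    _ = δ * volume (Metric.ball (0 : Euc d) 1) * ENNReal.ofReal (ρ ^ d) := by
        rw [Measure.addHaar_ball_of_pos _ _ hρ.1, finrank_euclideanSpace_fin]
        ring
    _ ≤ ε * ENNReal.ofReal (ρ ^ d) := by gcongr

/-- The direction `e` points into both half spaces, so their intersection with `B_ρ(x)` contains a
ball of radius proportional to `ρ`. There `u` is close to `p`; if `a ≠ p`, the scaled integral of
`‖u - a‖` stays bounded below. -/
lemma IsMeanLimit.eq_of_tendsto {d : ℕ} {u : Euc d → Euc d} {x w w' a p e : Euc d}
    (ha : IsMeanLimit u x w a) (hp : Tendsto u (𝓝[halfSpace x w'] x) (𝓝 p))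
    (he : 0 < inner ℝ e w) (he' : 0 < inner ℝ e w') : a = p := by
  by_contra hap
  have hδ : 0 < ‖p - a‖ / 2 := by
    have : 0 < ‖p - a‖ := norm_pos_iff.2 (sub_ne_zero.2 (Ne.symm hap))
    positivity
  have hopen : IsOpen {z : Euc d | 0 < inner ℝ z w ∧ 0 < inner ℝ z w' ∧ ‖z‖ < 1} :=
    (isOpen_lt (f := fun _ : Euc d => (0 : ℝ)) (g := fun z => inner ℝ z w) continuous_const
      (by fun_prop)).and ((isOpen_lt (f := fun _ : Euc d => (0 : ℝ)) (g := fun z => inner ℝ z w')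
        continuous_const (by fun_prop)).and (isOpen_lt continuous_norm continuous_const))
  -- Scaling `e` to norm below `1` keeps `x + ρ z` inside `B_ρ(x)` for all `z` near the scaled
  -- vector.
  have hmem : (‖e‖ + 1)⁻¹ • e ∈ {z : Euc d | 0 < inner ℝ z w ∧ 0 < inner ℝ z w' ∧ ‖z‖ < 1} := by
    have h1 : 0 < ‖e‖ + 1 := by positivity
    refine ⟨?_, ?_, ?_⟩
    · rw [real_inner_smul_left]; positivity
    · rw [real_inner_smul_left]; positivity
    · rw [norm_smul, norm_inv, Real.norm_of_nonneg h1.le, inv_mul_lt_iff₀ h1]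
      linarith
  obtain ⟨η, hη, hball⟩ := Metric.isOpen_iff.1 hopen _ hmem
  set z₀ := (‖e‖ + 1)⁻¹ • e
  have hK : 0 < ENNReal.ofReal (‖p - a‖ / 2) * volume (Metric.ball (0 : Euc d) η) :=
    ENNReal.mul_pos (ENNReal.ofReal_pos.2 hδ).ne' (Metric.measure_ball_pos volume _ hη).ne'
  have hev := hp.eventually (Metric.ball_mem_nhds p hδ)
  obtain ⟨r, hr, hr'⟩ := Metric.mem_nhdsWithin_iff.1 hev
  have hlt := ha.eventually (gt_mem_nhds hK)
  obtain ⟨ρ, hρ1, hρ2⟩ := (hlt.and (Ioo_mem_nhdsGT hr)).exists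
  refine hρ1.not_ge ?_
  have hρ0 := hρ2.1
  have hsub : Metric.ball (x + ρ • z₀) (ρ * η)
      ⊆ Metric.ball x ρ ∩ halfSpace x w ∩ halfSpace x w' := by
    intro y hy
    have hz : ρ⁻¹ • (y - x) ∈ Metric.ball z₀ η := by
      rw [mem_ball_iff_norm] at hy ⊢
      have : ρ⁻¹ • (y - x) - z₀ = ρ⁻¹ • (y - (x + ρ • z₀)) := by
        rw [← sub_sub, smul_sub ρ⁻¹ (y - x), smul_smul, inv_mul_cancel₀ hρ0.ne', one_smul]
      rw [this, norm_smul, norm_inv, Real.norm_of_nonneg hρ0.le, inv_mul_lt_iff₀ hρ0]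
      exact hy
    obtain ⟨h1, h2, h3⟩ := hball hz
    rw [real_inner_smul_left] at h1 h2
    rw [norm_smul, norm_inv, Real.norm_of_nonneg hρ0.le, inv_mul_lt_iff₀ hρ0, mul_one] at h3
    exact ⟨⟨mem_ball_iff_norm.2 h3, pos_of_mul_pos_right h1 (by positivity)⟩,
      pos_of_mul_pos_right h2 (by positivity)⟩
  rw [ENNReal.le_div_iff_mul_le (Or.inl (ENNReal.ofReal_pos.2 (by positivity)).ne')
    (Or.inl ENNReal.ofReal_ne_top)]
  calc ENNReal.ofReal (‖p - a‖ / 2) * volume (Metric.ball (0 : Euc d) η) * ENNReal.ofReal (ρ ^ d)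
      = ENNReal.ofReal (‖p - a‖ / 2) * volume (Metric.ball (x + ρ • z₀) (ρ * η)) := by
        rw [Measure.addHaar_ball_mul_of_pos _ _ hρ0, finrank_euclideanSpace_fin]
        ring
    _ = ∫⁻ y in Metric.ball (x + ρ • z₀) (ρ * η), ENNReal.ofReal (‖p - a‖ / 2) := by
        rw [setLIntegral_const]
    _ ≤ ∫⁻ y in Metric.ball (x + ρ • z₀) (ρ * η), ‖u y - a‖ₑ := by
        refine setLIntegral_mono' measurableSet_ball fun y hy => ?_
        have h1 := hsub hy
        have h2 : dist (u y) p < ‖p - a‖ / 2 :=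
          hr' ⟨Metric.ball_subset_ball hρ2.2.le h1.1.1, h1.2⟩
        rw [← ofReal_norm]
        refine ENNReal.ofReal_le_ofReal ?_
        have h3 := norm_sub_le_norm_sub_add_norm_sub p (u y) a
        rw [← dist_eq_norm p (u y), dist_comm] at h3
        linarith
    _ ≤ ∫⁻ y in Metric.ball x ρ ∩ halfSpace x w, ‖u y - a‖ₑ :=
        lintegral_mono_set fun y hy => (hsub hy).1

/-- Supplies the common direction `e = ν + ν'` of two half spaces whose normals are not antipodal.
-/
lemma inner_add_sph_pos {d : ℕ} {ν ν' : Sph d} (h : (ν' : Euc d) ≠ -(ν : Euc d)) :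
    0 < inner ℝ ((ν : Euc d) + ν') (ν : Euc d) ∧ 0 < inner ℝ ((ν : Euc d) + ν') (ν' : Euc d) := by
  have h1 : inner ℝ (ν : Euc d) (-(ν' : Euc d)) < 1 :=
    inner_lt_one_iff_real_of_norm_eq_one (norm_sph ν) (by rw [norm_neg, norm_sph]) |>.2
      fun e => h (by rw [e, neg_neg])
  rw [inner_neg_right] at h1
  rw [inner_add_left, inner_add_left, inner_sph_self, inner_sph_self,
    real_inner_comm (ν : Euc d) (ν' : Euc d)]
  constructor <;> linarith

lemma isJumpTriple_iff_of_tendsto {d : ℕ} {u : Euc d → Euc d} {x p q : Euc d} {ν : Sph d}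
    (hp : Tendsto u (𝓝[halfSpace x (ν : Euc d)] x) (𝓝 p))
    (hq : Tendsto u (𝓝[halfSpace x (-(ν : Euc d))] x) (𝓝 q)) {a b : Euc d} {ν' : Sph d} :
    IsJumpTriple u x a b ν' ↔
      a ≠ b ∧ (ν' = ν ∧ a = p ∧ b = q ∨ ν' = -ν ∧ a = q ∧ b = p) := by
  rw [isJumpTriple_iff]
  refine and_congr_right fun hab => ?_
  constructor
  · rintro ⟨ha, hb⟩
    have key1 : (ν' : Euc d) ≠ -(ν : Euc d) → a = p ∧ b = q := by
      intro h
      have h1 := inner_add_sph_pos h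
      refine ⟨ha.eq_of_tendsto hp h1.2 h1.1, hb.eq_of_tendsto hq (e := -((ν : Euc d) + ν')) ?_ ?_⟩
      · rw [inner_neg_neg]; exact h1.2
      · rw [inner_neg_neg]; exact h1.1
    have key2 : (ν' : Euc d) ≠ (ν : Euc d) → a = q ∧ b = p := by
      intro h
      have h1 := inner_add_sph_pos (ν := -ν) (ν' := ν') (by simpa using h)
      rw [coe_neg_sphere] at h1
      refine ⟨ha.eq_of_tendsto hq h1.2 h1.1,
        hb.eq_of_tendsto hp (e := -(-(ν : Euc d) + ν')) ?_ ?_⟩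
      · rw [inner_neg_neg]; exact h1.2
      · rw [inner_neg_left, ← inner_neg_right]; exact h1.1
    by_cases h1 : (ν' : Euc d) = (ν : Euc d)
    · refine Or.inl ⟨Subtype.ext h1, key1 fun h2 => ?_⟩
      have h3 := inner_sph_self ν
      have h4 := congrArg (fun z => inner ℝ z (ν : Euc d)) (h1.symm.trans h2)
      simp only [inner_neg_left, h3] at h4
      norm_num at h4
    · refine Or.inr ⟨?_, key2 h1⟩
      -- A normal different from both `ν` and `-ν` sees both one-sided limits on each side, which
      -- forces `a = b`.
      by_contra h2
      have h3 : (ν' : Euc d) ≠ -(ν : Euc d) := fun h => h2 (Subtype.ext (by simpa using h))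
      exact hab ((key1 h3).1.trans (key2 h1).2.symm)
  · rintro (⟨rfl, rfl, rfl⟩ | ⟨rfl, rfl, rfl⟩)
    · exact ⟨isMeanLimit_of_tendsto hp, isMeanLimit_of_tendsto hq⟩
    · rw [coe_neg_sphere, neg_neg]
      exact ⟨isMeanLimit_of_tendsto hq, isMeanLimit_of_tendsto hp⟩

lemma tendsto_profile_right {d : ℕ} (ν : Sph d) (ζ : Euc d) (μ : Measure ℝ) [IsFiniteMeasure μ]
    (x : Euc d) : Tendsto (profile ν ζ μ) (𝓝[halfSpace x (ν : Euc d)] x)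
      (𝓝 (μ.real (Iic (inner ℝ x (ν : Euc d))) • ζ)) := by
  refine ((tendsto_real_Iio_nhdsGT μ _).comp (tendsto_nhdsWithin_iff.2 ⟨?_, ?_⟩)).smul_const ζ
  · exact ((continuous_inner_sph ν).tendsto x).mono_left nhdsWithin_le_nhds
  · filter_upwards [self_mem_nhdsWithin] with y hy
    rw [halfSpace, mem_ofPred_eq, inner_sub_left, sub_pos] at hy
    exact hy

lemma tendsto_profile_left {d : ℕ} (ν : Sph d) (ζ : Euc d) (μ : Measure ℝ) [IsFiniteMeasure μ]
    (x : Euc d) : Tendsto (profile ν ζ μ) (𝓝[halfSpace x (-(ν : Euc d))] x)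
      (𝓝 (μ.real (Iio (inner ℝ x (ν : Euc d))) • ζ)) := by
  refine ((tendsto_real_Iio_nhdsLT μ _).comp (tendsto_nhdsWithin_iff.2 ⟨?_, ?_⟩)).smul_const ζ
  · exact ((continuous_inner_sph ν).tendsto x).mono_left nhdsWithin_le_nhds
  · filter_upwards [self_mem_nhdsWithin] with y hy
    rw [halfSpace, mem_ofPred_eq, inner_neg_right, inner_sub_left, neg_sub, sub_pos] at hy
    exact hy

lemma real_Iic_eq_add (μ : Measure ℝ) [IsFiniteMeasure μ] (t : ℝ) :
    μ.real (Iic t) = μ.real (Iio t) + μ.real {t} := by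
  rw [← Iio_union_right, measureReal_union (by simp) (measurableSet_singleton t)]

/-- The one-sided limits differ by `μ {⟨x, ν⟩} • ζ`, so jumps sit exactly over the atoms of `μ`. -/
lemma jumpSet_profile {d : ℕ} (ν : Sph d) {ζ : Euc d} (hζ : ζ ≠ 0) (μ : Measure ℝ)
    [IsFiniteMeasure μ] (U : Set (Euc d)) :
    jumpSet U (profile ν ζ μ) = {x | x ∈ U ∧ μ {inner ℝ x (ν : Euc d)} ≠ 0} := by
  ext x
  refine and_congr_right fun _ => ?_
  simp only [isJumpTriple_iff_of_tendsto (tendsto_profile_right ν ζ μ x)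
    (tendsto_profile_left ν ζ μ x)]
  have hne : μ.real (Iic (inner ℝ x (ν : Euc d))) • ζ ≠ μ.real (Iio (inner ℝ x (ν : Euc d))) • ζ
      ↔ μ {inner ℝ x (ν : Euc d)} ≠ 0 := by
    rw [Ne, (smul_left_injective ℝ hζ).eq_iff, real_Iic_eq_add, add_eq_left,
      measureReal_eq_zero_iff]
  constructor
  · rintro ⟨a, b, ν', hab, ⟨_, rfl, rfl⟩ | ⟨_, rfl, rfl⟩⟩
    · exact hne.1 hab
    · exact hne.1 hab.symm
  · exact fun h => ⟨_, _, ν, hne.2 h, Or.inl ⟨rfl, rfl, rfl⟩⟩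

lemma surfaceDensity_profile {d : ℕ} {g : Euc d → Sph d → ℝ≥0}
    (hg : ∀ ζ ν, g ζ ν = g (-ζ) (-ν)) (ν : Sph d) {ζ : Euc d} (μ : Measure ℝ)
    [IsFiniteMeasure μ] {U : Set (Euc d)} {x : Euc d} (hx : x ∈ jumpSet U (profile ν ζ μ)) :
    surfaceDensity g (profile ν ζ μ) x = g (μ.real {inner ℝ x (ν : Euc d)} • ζ) ν := by
  have hex : ∃ p : Euc d × Euc d × Sph d, IsJumpTriple (profile ν ζ μ) x p.1 p.2.1 p.2.2 := by
    obtain ⟨_, a, b, ν', h⟩ := hx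
    exact ⟨(a, b, ν'), h⟩
  have hs := hex.choose_spec
  rw [isJumpTriple_iff_of_tendsto (tendsto_profile_right ν ζ μ x)
    (tendsto_profile_left ν ζ μ x)] at hs
  have e : μ.real (Iic (inner ℝ x (ν : Euc d))) • ζ - μ.real (Iio (inner ℝ x (ν : Euc d))) • ζ
      = μ.real {inner ℝ x (ν : Euc d)} • ζ := by
    rw [← sub_smul, real_Iic_eq_add, add_sub_cancel_left]
  rw [surfaceDensity, dif_pos hex]
  -- The chosen triple has one of two orientations; evenness of `g` makes them give the same value.
  rcases hs.2 with ⟨h1, h2, h3⟩ | ⟨h1, h2, h3⟩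
  · rw [h1, h2, h3, e]
  · rw [h1, h2, h3, hg, neg_sub, neg_neg, e]

/-! ### The energy of ramps and staircases -/

/-- Lebesgue measure on an interval times a constant; its profile is piecewise affine. -/
def rampMeasure (c : ℝ≥0) (α β : ℝ) : Measure ℝ := c • volume.restrict (Ioo α β)

instance (c : ℝ≥0) (α β : ℝ) : IsFiniteMeasure (rampMeasure c α β) := by
  unfold rampMeasure
  infer_instance

/-- A finite sum of Dirac masses times a constant; its profile is piecewise constant. -/
def stairMeasure (c : ℝ≥0) (J : Finset ℝ) : Measure ℝ := c • ∑ r ∈ J, Measure.dirac r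

instance (c : ℝ≥0) (J : Finset ℝ) : IsFiniteMeasure (stairMeasure c J) := by
  unfold stairMeasure
  infer_instance

/-- The open region `{x | α < ⟨x, ν⟩ < β}`. -/
def strip {d : ℕ} (ν : Sph d) (α β : ℝ) : Set (Euc d) :=
  (fun x => inner ℝ x (ν : Euc d)) ⁻¹' Ioo α β

lemma measurableSet_strip {d : ℕ} (ν : Sph d) (α β : ℝ) : MeasurableSet (strip ν α β) :=
  measurable_inner_sph ν measurableSet_Ioo

lemma plate_preimage_inner {d : ℕ} (ν : Sph d) (μ : Measure ℝ) [SFinite μ] (S : Set ℝ) :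
    plate ν μ ((fun x => inner ℝ x (ν : Euc d)) ⁻¹' S) = μ S * volume (univ : Set (Hyp ν)) := by
  rw [plate, MeasurableEquiv.map_apply, ← Measure.prod_prod]
  congr 1
  ext p
  simp [inner_sliceEquiv]

lemma plate_volume {d : ℕ} (ν : Sph d) : plate ν volume = volume :=
  (measurePreserving_sliceEquiv ν).map_eq

lemma plate_rampMeasure {d : ℕ} (ν : Sph d) (c : ℝ≥0) (α β : ℝ) :
    plate ν (rampMeasure c α β) = c • volume.restrict (strip ν α β) := by
  have h1 : (volume.restrict (Ioo α β)).prod (volume : Measure (Hyp ν))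
      = (volume.prod volume).restrict (sliceEquiv ν ⁻¹' strip ν α β) := by
    have h2 := Measure.prod_restrict (μ := (volume : Measure ℝ)) (ν := (volume : Measure (Hyp ν)))
      (Ioo α β) univ
    rw [Measure.restrict_univ] at h2
    rw [h2]
    congr 1
    ext p
    simp [inner_sliceEquiv, strip]
  rw [plate, rampMeasure, Measure.prod_smul_left, Measure.map_smul, h1,
    ← MeasurableEquiv.restrict_map, (measurePreserving_sliceEquiv ν).map_eq]

/-- The factor `F` in the total variation cancels the normalisation of the polar density. -/
lemma absContDensity_ramp {d : ℕ} (ν : Sph d) {ζ : Euc d} (hζ : ζ ≠ 0) {c : ℝ≥0} (hc : c ≠ 0)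
    (α β : ℝ) {U : Set (Euc d)} (hU : IsOpen U) :
    totalVar U (profile ν ζ (rampMeasure c α β)) ≪ volume ∧
    ∀ᵐ x ∂(volume : Measure (Euc d)), x ∈ U →
      (x ∈ strip ν α β → absContDensity U (profile ν ζ (rampMeasure c α β)) x
        = (c : ℝ) • symTensor ζ (ν : Euc d)) ∧
      (x ∉ strip ν α β → absContDensity U (profile ν ζ (rampMeasure c α β)) x = 0) := by
  have hA := frob_pos (symTensor_ne_zero hζ ν)
  set F := frob (symTensor ζ (ν : Euc d))
  have hsg := isSymGrad_profile ν hζ (rampMeasure c α β) hU.measurableSet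
  obtain ⟨h1, h2⟩ := hsg.totalVar_eq hU
  have hS := measurableSet_strip ν α β
  have hC : ENNReal.ofReal F * c ≠ 0 :=
    mul_ne_zero (ENNReal.ofReal_pos.2 hA).ne' (by exact_mod_cast hc)
  have hvar : profileVar ν ζ (rampMeasure c α β) U
      = (ENNReal.ofReal F * c) • volume.restrict (U ∩ strip ν α β) := by
    rw [profileVar, plate_rampMeasure, Measure.restrict_smul, Measure.restrict_restrict
      hU.measurableSet, mul_smul]
    rfl
  have hdens : profileVar ν ζ (rampMeasure c α β) U = volume.withDensity
      ((U ∩ strip ν α β).indicator fun _ => ENNReal.ofReal F * c) := by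
    rw [hvar, withDensity_indicator (hU.measurableSet.inter hS), withDensity_const]
  have hrn := Measure.rnDeriv_withDensity (volume : Measure (Euc d))
    (measurable_const (a := ENNReal.ofReal F * c)|>.indicator (hU.measurableSet.inter hS))
  rw [← hdens, ← h1] at hrn
  rw [hvar, EventuallyEq, Measure.ae_ennreal_smul_measure_iff hC,
    ae_restrict_iff' (hU.measurableSet.inter hS)] at h2
  refine ⟨by rw [h1, hdens]; exact withDensity_absolutelyContinuous _ _, ?_⟩
  filter_upwards [hrn, h2] with x hx1 hx2 hxU
  constructor
  · intro hxS
    rw [absContDensity, hx1, ← hx2 ⟨hxU, hxS⟩, indicator_of_mem (show x ∈ U ∩ _ from ⟨hxU, hxS⟩),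
      smul_smul, ENNReal.toReal_mul, ENNReal.toReal_ofReal hA.le, ENNReal.coe_toReal]
    congr 1
    rw [mul_right_comm, mul_inv_cancel₀ hA.ne', one_mul]
  · intro hxS
    rw [absContDensity, hx1, indicator_of_notMem (fun h => hxS h.2)]
    simp

lemma energy_ramp {d : ℕ} (f : SymMat d → ℝ≥0) (g : Euc d → Sph d → ℝ≥0) (ν : Sph d) {ζ : Euc d}
    (hζ : ζ ≠ 0) {c : ℝ≥0} (hc : c ≠ 0) (α β : ℝ) {U : Set (Euc d)} (hU : IsOpen U) :
    energy f g (profile ν ζ (rampMeasure c α β)) U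
      = f ((c : ℝ) • symTensor ζ (ν : Euc d)) * volume (U ∩ strip ν α β)
        + f 0 * volume (U \ strip ν α β) := by
  obtain ⟨hac, hd⟩ := absContDensity_ramp ν hζ hc α β hU
  have hS := measurableSet_strip ν α β
  have hJ : jumpSet U (profile ν ζ (rampMeasure c α β)) = ∅ := by
    rw [jumpSet_profile ν hζ]
    ext x
    simp [rampMeasure]
  have hcan : cantorVar U (profile ν ζ (rampMeasure c α β)) = 0 := by
    rw [cantorVar, Measure.singularPart_eq_zero_of_ac hac, Measure.restrict_zero]
  rw [energy, if_pos (memBDLoc_profile ν hζ _ U), hJ, hcan, Measure.restrict_empty,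
    lintegral_zero_measure, lintegral_zero_measure, add_zero, add_zero,
    ← lintegral_inter_add_sdiff _ U hS]
  congr 1
  · rw [← setLIntegral_const]
    refine setLIntegral_congr_fun_ae (hU.measurableSet.inter hS) ?_
    filter_upwards [hd] with x hx hxU
    rw [(hx hxU.1).1 hxU.2]
  · rw [← setLIntegral_const]
    refine setLIntegral_congr_fun_ae (hU.measurableSet.diff hS) ?_
    filter_upwards [hd] with x hx hxU
    rw [(hx hxU.1).2 hxU.2]

lemma stairMeasure_singleton (c : ℝ≥0) (J : Finset ℝ) (t : ℝ) :
    stairMeasure c J {t} = if t ∈ J then (c : ℝ≥0∞) else 0 := by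
  classical
  have h : ∀ r ∈ J, Measure.dirac r {t} = if r = t then (1 : ℝ≥0∞) else 0 := by
    intro r _
    rw [Measure.dirac_apply' _ (measurableSet_singleton t)]
    simp [indicator]
  rw [stairMeasure, Measure.smul_apply, Measure.finsetSum_apply, Finset.sum_congr rfl h,
    Finset.sum_ite_eq']
  split_ifs <;> simp [ENNReal.smul_def]

lemma stairMeasure_compl (c : ℝ≥0) (J : Finset ℝ) : stairMeasure c J (J : Set ℝ)ᶜ = 0 := by
  rw [stairMeasure, Measure.smul_apply, Measure.finsetSum_apply, Finset.sum_eq_zero, smul_zero]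
  intro r hr
  rw [Measure.dirac_apply' _ J.measurableSet.compl]
  simp [hr]

/-- `Eu` is concentrated on the hyperplanes over `J`, which are Lebesgue null and make up the jump
set in `U`. So the Cantor part vanishes, `ℰu = 0` almost everywhere, and homogeneity takes the step
height `c` out of `g`. -/
lemma energy_stair {d : ℕ} (f : SymMat d → ℝ≥0) {g : Euc d → Sph d → ℝ≥0}
    (hg : ∀ ζ ν, g ζ ν = g (-ζ) (-ν)) (hg_hom : ∀ ζ ν, ∀ t : ℝ≥0, g (t • ζ) ν = t * g ζ ν)
    (ν : Sph d) {ζ : Euc d} (hζ : ζ ≠ 0) {c : ℝ≥0} (hc : c ≠ 0) (J : Finset ℝ)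
    {U : Set (Euc d)} (hU : IsOpen U) :
    energy f g (profile ν ζ (stairMeasure c J)) U
      = f 0 * volume U + c * g ζ ν * ∑ r ∈ J, sliceVol ν U r := by
  set u := profile ν ζ (stairMeasure c J) with hu
  set T : Set (Euc d) := (fun x => inner ℝ x (ν : Euc d)) ⁻¹' J with hT
  have hTm : MeasurableSet T := measurable_inner_sph ν J.measurableSet
  have hsg := isSymGrad_profile ν hζ (stairMeasure c J) hU.measurableSet
  have hvar : totalVar U u = profileVar ν ζ (stairMeasure c J) U := (hsg.totalVar_eq hU).1
  have hTc : totalVar U u Tᶜ = 0 := by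
    rw [hvar, profileVar, Measure.smul_apply, smul_eq_mul]
    refine mul_eq_zero_of_right _ (le_antisymm ((Measure.restrict_le_self _).trans ?_) zero_le)
    -- The hyperplane may have infinite volume; here and in `hT0` the convention `0 * ∞ = 0` is
    -- used.
    rw [hT, ← preimage_compl, plate_preimage_inner, stairMeasure_compl, zero_mul]
  have hT0 : volume T = 0 := by
    rw [← plate_volume ν, hT, plate_preimage_inner, J.finite_toSet.measure_zero, zero_mul]
  have hsing : totalVar U u ⟂ₘ volume := ⟨Tᶜ, hTm.compl, hTc, by rwa [compl_compl]⟩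
  have hJ : jumpSet U u = U ∩ T := by
    rw [hu, jumpSet_profile ν hζ]
    ext x
    simp [stairMeasure_singleton, hc, hT]
  have hcan : cantorVar U u = 0 := by
    rw [cantorVar, Measure.restrict_eq_zero, hJ]
    refine le_antisymm ((Measure.singularPart_le _ _ _).trans ?_) zero_le
    rw [← hTc]
    exact measure_mono fun x hx hxT => hx.2 ⟨hx.1, hxT⟩
  have habs : ∫⁻ x in U, (f (absContDensity U u x) : ℝ≥0∞) = f 0 * volume U := by
    rw [← setLIntegral_const]
    refine setLIntegral_congr_fun_ae hU.measurableSet ?_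
    have : SigmaFinite (totalVar U u) := by rw [hvar]; exact hsg.sigmaFinite hU
    filter_upwards [hsing.rnDeriv_ae_eq_zero] with x hx _
    rw [absContDensity, hx]
    simp
  have hsurf : ∫⁻ x in jumpSet U u, (surfaceDensity g u x : ℝ≥0∞) ∂μHE[d - 1]
      = c * g ζ ν * ∑ r ∈ J, sliceVol ν U r := by
    have h1 : ∫⁻ x in jumpSet U u, (surfaceDensity g u x : ℝ≥0∞) ∂μHE[d - 1]
        = ∫⁻ x in jumpSet U u, (c * g ζ ν : ℝ≥0∞) ∂μHE[d - 1] := by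
      refine setLIntegral_congr_fun (by rw [hJ]; exact hU.measurableSet.inter hTm) fun x hx => ?_
      have hxJ : inner ℝ x (ν : Euc d) ∈ J := by
        rw [hJ] at hx
        exact hx.2
      have h2 : (stairMeasure c J).real {inner ℝ x (ν : Euc d)} = c := by
        simp [Measure.real, stairMeasure_singleton, hxJ]
      have h3 : surfaceDensity g u x = c * g ζ ν := by
        rw [hu, surfaceDensity_profile hg ν _ hx, h2, ← hg_hom]
        rfl
      simp only [h3, ENNReal.coe_mul]
    have h4 : U ∩ T = ⋃ r ∈ J, U ∩ level ν r := by
      ext x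
      simp [hT, level]
    rw [h1, setLIntegral_const, hJ, h4, measure_biUnion_finset]
    · rfl
    · intro r _ r' _ hrr'
      refine disjoint_left.2 fun x hx hx' => hrr' ?_
      exact hx.2.symm.trans hx'.2
    · exact fun r _ => hU.measurableSet.inter (measurableSet_level ν r)
  rw [energy, if_pos (memBDLoc_profile ν hζ _ U), hcan, lintegral_zero_measure, add_zero, habs,
    hsurf]

/-! ### Lower semicontinuity along sequences of profiles -/

lemma memLp_profile {d : ℕ} (ν : Sph d) (ζ : Euc d) (μ : Measure ℝ) [IsFiniteMeasure μ]
    {U : Set (Euc d)} (hb : Bornology.IsBounded U) :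
    MemLp (profile ν ζ μ) 1 (volume.restrict U) :=
  memLp_one_iff_integrable.2 (integrableOn_profile ν ζ μ hb.measure_lt_top)

/-- A uniform mass bound and pointwise convergence of the distribution functions on `U` give `L¹`
convergence by dominated convergence; `energy_congr` passes between the profiles and their `L¹`
classes. -/
lemma L1LowerSemicontinuous.energy_profile_le {d : ℕ} {f : SymMat d → ℝ≥0}
    {g : Euc d → Sph d → ℝ≥0} {U : Set (Euc d)} (hlsc : L1LowerSemicontinuous f g U)
    (hU : IsOpen U) (hb : Bornology.IsBounded U) (ν : Sph d) (ζ : Euc d)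
    (μs : ℕ → Measure ℝ) [∀ k, IsFiniteMeasure (μs k)] (μ : Measure ℝ) [IsFiniteMeasure μ]
    {M : ℝ} (hM : ∀ k, (μs k).real univ ≤ M)
    (hlim : ∀ x ∈ U, Tendsto (fun k => (μs k).real (Iio (inner ℝ x (ν : Euc d)))) atTop
      (𝓝 (μ.real (Iio (inner ℝ x (ν : Euc d)))))) :
    energy f g (profile ν ζ μ) U ≤ liminf (fun k => energy f g (profile ν ζ (μs k)) U) atTop := by
  have hconv : Tendsto (fun k => (memLp_profile ν ζ (μs k) hb).toLp (profile ν ζ (μs k))) atTop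
      (𝓝 ((memLp_profile ν ζ μ hb).toLp (profile ν ζ μ))) := by
    rw [Lp.tendsto_Lp_iff_tendsto_eLpNorm'']
    simp only [eLpNorm_one_eq_lintegral_enorm, Pi.sub_apply]
    have hz : ∫⁻ _ : Euc d, (0 : ℝ≥0∞) ∂(volume.restrict U) = 0 := lintegral_zero
    rw [← hz]
    refine tendsto_lintegral_of_dominated_convergence
      (fun _ => ENNReal.ofReal (M * ‖ζ‖ + μ.real univ * ‖ζ‖))
      (fun k => ((measurable_profile ν ζ (μs k)).sub (measurable_profile ν ζ μ)).enorm)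
      (fun k => Eventually.of_forall fun x => ?_) ?_ ?_
    · beta_reduce
      rw [← ofReal_norm]
      refine ENNReal.ofReal_le_ofReal ((norm_sub_le _ _).trans (add_le_add ?_ ?_))
      · exact (norm_profile_le ν ζ (μs k) x).trans
          (mul_le_mul_of_nonneg_right (hM k) (norm_nonneg ζ))
      · exact norm_profile_le ν ζ μ x
    · rw [setLIntegral_const]
      exact ENNReal.mul_ne_top ENNReal.ofReal_ne_top hb.measure_lt_top.ne
    · filter_upwards [ae_restrict_mem hU.measurableSet] with x hx
      have h1 : Tendsto (fun k => profile ν ζ (μs k) x - profile ν ζ μ x) atTop (𝓝 0) := by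
        rw [tendsto_sub_nhds_zero_iff]
        exact (hlim x hx).smul_const ζ
      simpa using h1.enorm
  have h1 := (hlsc.le_liminf _).trans (hconv.liminf_le_liminf_comp
    (u := fun u : Lp (Euc d) 1 (volume.restrict U) => energy f g u U))
  rw [energy_congr f g hU (memLp_profile ν ζ μ hb).coeFn_toLp] at h1
  refine h1.trans_eq (congrArg (fun F => liminf F atTop) (funext fun k => ?_))
  exact energy_congr f g hU (memLp_profile ν ζ (μs k) hb).coeFn_toLp

lemma rampMeasure_real_Iio (c : ℝ≥0) (α β t : ℝ) :
    (rampMeasure c α β).real (Iio t) = c * max (min β t - α) 0 := by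
  rw [rampMeasure, Measure.real, Measure.smul_apply, Measure.restrict_apply measurableSet_Iio,
    inter_comm, Ioo_inter_Iio, Real.volume_Ioo, ENNReal.smul_def, smul_eq_mul, ENNReal.toReal_mul,
    ENNReal.toReal_ofReal', ENNReal.coe_toReal]

lemma rampMeasure_real_univ (c : ℝ≥0) (α β : ℝ) :
    (rampMeasure c α β).real univ = c * max (β - α) 0 := by
  rw [rampMeasure, Measure.real, Measure.smul_apply, Measure.restrict_apply_univ,
    Real.volume_Ioo, ENNReal.smul_def, smul_eq_mul, ENNReal.toReal_mul,
    ENNReal.toReal_ofReal', ENNReal.coe_toReal]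

lemma stairMeasure_real (c : ℝ≥0) (J : Finset ℝ) {S : Set ℝ} (hS : MeasurableSet S)
    [DecidablePred (· ∈ S)] :
    (stairMeasure c J).real S = c * (J.filter (· ∈ S)).card := by
  have h : ∀ r ∈ J, Measure.dirac r S = if r ∈ S then (1 : ℝ≥0∞) else 0 := by
    intro r _
    rw [Measure.dirac_apply' _ hS]
    simp [indicator]
  rw [Measure.real, stairMeasure, Measure.smul_apply, Measure.finsetSum_apply,
    Finset.sum_congr rfl h, Finset.sum_boole, ENNReal.smul_def, smul_eq_mul, ENNReal.toReal_mul,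
    ENNReal.coe_toReal, ENNReal.toReal_natCast]

/-! ### The surface density is at most the recession function -/

/-- Fubini in `(s, x)`: each point of `U` lies in the strip for a set of `s` of length `δ`. -/
lemma measurable_volume_strip {d : ℕ} (ν : Sph d) {U : Set (Euc d)} (hU : MeasurableSet U)
    (δ : ℝ) : Measurable (fun s => volume (U ∩ strip ν s (s + δ))) ∧
      ∫⁻ s, volume (U ∩ strip ν s (s + δ)) = ENNReal.ofReal δ * volume U := by
  set T : Set (ℝ × Euc d) := {p | p.2 ∈ U ∧ p.1 < inner ℝ p.2 (ν : Euc d) ∧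
    inner ℝ p.2 (ν : Euc d) < p.1 + δ} with hT
  have hm : Measurable fun p : ℝ × Euc d => inner ℝ p.2 (ν : Euc d) :=
    (measurable_inner_sph ν).comp measurable_snd
  have hTm : MeasurableSet T := (measurable_snd hU).inter
    ((measurableSet_lt measurable_fst hm).inter
      (measurableSet_lt hm (measurable_fst.add_const δ)))
  refine ⟨measurable_measure_prodMk_left hTm, ?_⟩
  calc ∫⁻ s, volume (U ∩ strip ν s (s + δ))
      = (volume.prod volume) T := (Measure.prod_apply hTm).symm
    _ = ∫⁻ x, volume ((fun s => (s, x)) ⁻¹' T) := Measure.prod_apply_symm hTm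
    _ = ∫⁻ x, U.indicator (fun _ => ENNReal.ofReal δ) x := by
        refine lintegral_congr fun x => ?_
        by_cases hx : x ∈ U
        · have : (fun s => (s, x)) ⁻¹' T
              = Ioo (inner ℝ x (ν : Euc d) - δ) (inner ℝ x (ν : Euc d)) := by
            ext s
            simp [hT, hx, sub_lt_iff_lt_add, and_comm]
          rw [this, Real.volume_Ioo, indicator_of_mem hx]
          congr 1
          ring
        · have : (fun s => (s, x)) ⁻¹' T = ∅ := by
            ext s
            simp [hT, hx]
          rw [this, measure_empty, indicator_of_notMem hx]
    _ = ENNReal.ofReal δ * volume U := by rw [lintegral_indicator hU, setLIntegral_const]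

/-- The sequence is eventually constant: for `s < t` the whole ramp lies below `t` once its width is
less than `t - s`, and for `t ≤ s` both sides are `0`. -/
lemma tendsto_ramp_stair (s t : ℝ) :
    Tendsto (fun k : ℕ => (rampMeasure (k + 1) s (s + (k + 1 : ℝ)⁻¹)).real (Iio t)) atTop
      (𝓝 ((stairMeasure 1 {s}).real (Iio t))) := by
  classical
  rw [stairMeasure_real 1 {s} measurableSet_Iio]
  refine tendsto_const_nhds.congr' ?_
  by_cases hst : s < t
  · have h0 : Tendsto (fun k : ℕ => (k + 1 : ℝ)⁻¹) atTop (𝓝 0) := by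
      simpa using tendsto_one_div_add_atTop_nhds_zero_nat (𝕜 := ℝ)
    filter_upwards [h0.eventually (gt_mem_nhds (sub_pos.2 hst))] with k hk
    have hk0 : (0 : ℝ) < (k + 1 : ℝ)⁻¹ := by positivity
    rw [rampMeasure_real_Iio, min_eq_left (by linarith), add_sub_cancel_left, max_eq_left hk0.le]
    have h1 : (k + 1 : ℝ) ≠ 0 := by positivity
    simp [hst, h1, Finset.filter_singleton]
  · refine Eventually.of_forall fun k => ?_
    beta_reduce
    rw [rampMeasure_real_Iio, max_eq_right]
    · simp [hst, Finset.filter_singleton]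
    · have := min_le_right (s + (k + 1 : ℝ)⁻¹) t
      linarith

lemma surface_le_recession {d : ℕ} {f : SymMat d → ℝ≥0} {g : Euc d → Sph d → ℝ≥0}
    (hg : ∀ ζ ν, g ζ ν = g (-ζ) (-ν)) (hg_hom : ∀ ζ ν, ∀ t : ℝ≥0, g (t • ζ) ν = t * g ζ ν)
    {U : Set (Euc d)} (hU : IsOpen U) (hb : Bornology.IsBounded U) (hne : U.Nonempty)
    (hlsc : L1LowerSemicontinuous f g U) {ζ : Euc d} (hζ : ζ ≠ 0) (ν : Sph d) :
    (g ζ ν : ℝ≥0∞) ≤ recession f (symTensor ζ (ν : Euc d)) := by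
  set A := symTensor ζ (ν : Euc d)
  have hvol : volume U ≠ ⊤ := hb.measure_lt_top.ne
  have hvol0 : volume U ≠ 0 := (hU.measure_pos volume hne).ne'
  have hslice : ∀ s, (g ζ ν : ℝ≥0∞) * sliceVol ν U s ≤ liminf (fun k : ℕ =>
      (f ((k + 1 : ℝ) • A) : ℝ≥0∞) * volume (U ∩ strip ν s (s + (k + 1 : ℝ)⁻¹))) atTop := by
    intro s
    have h1 := hlsc.energy_profile_le hU hb ν ζ
      (fun k : ℕ => rampMeasure (k + 1) s (s + (k + 1 : ℝ)⁻¹)) (stairMeasure 1 {s}) (M := 1)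
      (fun k => by
        have h1 : (k + 1 : ℝ) ≠ 0 := by positivity
        rw [rampMeasure_real_univ, add_sub_cancel_left, max_eq_left (by positivity)]
        simp [h1])
      (fun x _ => tendsto_ramp_stair s _)
    rw [energy_stair f hg hg_hom ν hζ one_ne_zero _ hU, Finset.sum_singleton, ENNReal.coe_one,
      one_mul] at h1
    have h2 : liminf (fun k : ℕ => energy f g (profile ν ζ
          (rampMeasure (k + 1) s (s + (k + 1 : ℝ)⁻¹))) U) atTop
        ≤ liminf (fun k : ℕ => (f 0 : ℝ≥0∞) * volume U + (f ((k + 1 : ℝ) • A) : ℝ≥0∞)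
          * volume (U ∩ strip ν s (s + (k + 1 : ℝ)⁻¹))) atTop := by
      refine liminf_le_liminf (Eventually.of_forall fun k => ?_)
      rw [energy_ramp f g ν hζ (by positivity) _ _ hU, add_comm]
      -- Enlarging the region outside the strip to `U` makes the `f 0` term independent of `k`;
      -- being finite, it then cancels.
      refine add_le_add (mul_le_mul_right (measure_mono sdiff_subset) _) (le_of_eq ?_)
      simp [A]
    have h3 := h1.trans h2
    rw [liminf_const_add _ _ _ (by isBoundedDefault) (by isBoundedDefault)] at h3
    exact (ENNReal.add_le_add_iff_left (ENNReal.mul_ne_top ENNReal.coe_ne_top hvol)).1 h3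
  have hmain : (g ζ ν : ℝ≥0∞) * volume U ≤ volume U * recession f A := by
    calc (g ζ ν : ℝ≥0∞) * volume U
        = ∫⁻ s, (g ζ ν : ℝ≥0∞) * sliceVol ν U s := by
          rw [lintegral_const_mul _ (measurable_sliceVol ν hU.measurableSet),
            lintegral_sliceVol ν hU.measurableSet]
      _ ≤ ∫⁻ s, liminf (fun k : ℕ => (f ((k + 1 : ℝ) • A) : ℝ≥0∞)
            * volume (U ∩ strip ν s (s + (k + 1 : ℝ)⁻¹))) atTop := lintegral_mono hslice
      _ ≤ liminf (fun k : ℕ => ∫⁻ s, (f ((k + 1 : ℝ) • A) : ℝ≥0∞)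
            * volume (U ∩ strip ν s (s + (k + 1 : ℝ)⁻¹))) atTop :=
          lintegral_liminf_le fun k =>
            (measurable_volume_strip ν hU.measurableSet _).1.const_mul _
      _ = liminf (fun k : ℕ => volume U *
            ((f ((k + 1 : ℝ) • A) : ℝ≥0∞) / ENNReal.ofReal (k + 1 : ℝ))) atTop := by
          congr 1
          ext k
          have hk := measurable_volume_strip ν hU.measurableSet (k + 1 : ℝ)⁻¹
          rw [lintegral_const_mul _ hk.1, hk.2, ENNReal.ofReal_inv_of_pos (by positivity),
            ENNReal.div_eq_inv_mul]
          ring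
      _ ≤ limsup (fun k : ℕ => volume U *
            ((f ((k + 1 : ℝ) • A) : ℝ≥0∞) / ENNReal.ofReal (k + 1 : ℝ))) atTop :=
          liminf_le_limsup
      _ = volume U * limsup (fun k : ℕ =>
            (f ((k + 1 : ℝ) • A) : ℝ≥0∞) / ENNReal.ofReal (k + 1 : ℝ)) atTop :=
          ENNReal.limsup_const_mul_of_ne_top hvol
      _ ≤ volume U * recession f A := by
          -- A limsup along the integers `k + 1` is at most the limsup over real `t`.
          refine mul_le_mul_right ?_ _
          exact (tendsto_atTop_add_const_right atTop (1 : ℝ)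
            tendsto_natCast_atTop_atTop).limsup_comp_le_limsup
            (u := fun t : ℝ => (f (t • A) : ℝ≥0∞) / ENNReal.ofReal t)
  rw [mul_comm] at hmain
  exact (ENNReal.mul_le_mul_iff_right hvol0 hvol).1 hmain

/-! ### The recession function is at most the surface density -/

/-- Some shift does no worse than the average over `(0, δ]`. The translates of `(0, δ]` are
disjoint, so the integral of the sum is at most that of `H`. -/
lemma exists_sum_shift_le {H : ℝ → ℝ≥0∞} (hH : Measurable H) (a : ℝ) {δ : ℝ} (hδ : 0 < δ)
    (N : ℕ) : ∃ σ ∈ Ioc 0 δ, ∑ j ∈ Finset.range N, H (a + j * δ + σ)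
      ≤ (∫⁻ r, H r) / ENNReal.ofReal δ := by
  have hv : volume (Ioc 0 δ) = ENNReal.ofReal δ := by rw [Real.volume_Ioc, sub_zero]
  have hm : ∀ j : ℕ, Measurable fun σ => H (a + j * δ + σ) := fun j =>
    hH.comp (measurable_const_add _)
  obtain ⟨σ, hσ, h⟩ := exists_le_setLAverage (μ := volume) (s := Ioc 0 δ)
    (f := fun σ => ∑ j ∈ Finset.range N, H (a + j * δ + σ))
    (by rw [hv]; exact (ENNReal.ofReal_pos.2 hδ).ne') (by rw [hv]; exact ENNReal.ofReal_ne_top)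
    (Finset.measurable_sum _ fun j _ => hm j).aemeasurable
  refine ⟨σ, hσ, h.trans ?_⟩
  rw [setLAverage_eq, hv]
  refine ENNReal.div_le_div_right ?_ _
  rw [lintegral_finsetSum _ fun j _ => hm j]
  have hshift : ∀ j : ℕ, ∫⁻ σ in Ioc 0 δ, H (a + j * δ + σ)
      = ∫⁻ r in Ioc (a + j * δ) (a + (j + 1) * δ), H r := by
    intro j
    have hpre : (fun σ => a + j * δ + σ) ⁻¹' Ioc (a + j * δ) (a + (j + 1) * δ) = Ioc 0 δ := by
      rw [preimage_const_add_Ioc]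
      congr 1 <;> ring
    rw [← hpre]
    exact (measurePreserving_add_left volume (a + j * δ)).setLIntegral_comp_preimage
      measurableSet_Ioc hH
  simp_rw [hshift]
  rw [← lintegral_biUnion_finset _ fun _ _ => measurableSet_Ioc]
  · exact setLIntegral_le_lintegral _ _
  · intro i _ j _ hij
    have := pairwise_disjoint_Ioc_add_zsmul a δ (show (i : ℤ) ≠ j by exact_mod_cast hij)
    simpa [Function.onFun] using this

/-- Staircases with step height `t / (k + 1)` and spacing `1 / (k + 1)`, shifted by a good `σ k`,
approximate a ramp that is affine on all of `U`. The total slice area is at most `(k + 1) |U|`,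
which balances the step height. -/
lemma energy_affine_le {d : ℕ} {f : SymMat d → ℝ≥0} {g : Euc d → Sph d → ℝ≥0}
    (hg : ∀ ζ ν, g ζ ν = g (-ζ) (-ν)) (hg_hom : ∀ ζ ν, ∀ t : ℝ≥0, g (t • ζ) ν = t * g ζ ν)
    {U : Set (Euc d)} (hU : IsOpen U) (hb : Bornology.IsBounded U)
    (hlsc : L1LowerSemicontinuous f g U) {ζ : Euc d} (hζ : ζ ≠ 0) (ν : Sph d)
    {t : ℝ≥0} (ht : t ≠ 0) :
    (f ((t : ℝ) • symTensor ζ (ν : Euc d)) : ℝ≥0∞) * volume U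
      ≤ f 0 * volume U + t * g ζ ν * volume U := by
  classical
  obtain ⟨R, hR⟩ := hb.subset_ball 0
  -- An integer bound makes the length `L = 2 * m` of the covering interval an integer, so it
  -- contains exactly `L * (k + 1)` spacings.
  obtain ⟨m, hRm⟩ := exists_nat_gt R
  have hstrip : U ⊆ strip ν (-m) (-m + (2 * m : ℕ)) := by
    intro x hx
    have h1 := (abs_real_inner_le_norm x (ν : Euc d)).trans_lt (by
      rw [norm_sph, mul_one]
      exact (mem_ball_zero_iff.1 (hR hx)).trans hRm)
    rw [abs_lt] at h1
    refine ⟨h1.1, ?_⟩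
    push_cast
    linarith [h1.2]
  set L := 2 * m
  set a : ℝ := -m
  have hδ : ∀ k : ℕ, (0 : ℝ) < (k + 1 : ℝ)⁻¹ := fun k => by positivity
  choose σ hσ hsum using fun k : ℕ =>
    exists_sum_shift_le (measurable_sliceVol ν hU.measurableSet) a (hδ k) (L * (k + 1))
  have hinj : ∀ k : ℕ, Function.Injective fun j : ℕ => a + j * (k + 1 : ℝ)⁻¹ + σ k := by
    intro k i j hij
    have h1 := mul_right_cancel₀ (hδ k).ne' (add_left_cancel (add_right_cancel hij))
    exact_mod_cast h1
  set J : ℕ → Finset ℝ := fun k =>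
    (Finset.range (L * (k + 1))).image fun j : ℕ => a + j * (k + 1 : ℝ)⁻¹ + σ k with hJ
  -- The number of jumps below `τ` differs from `(k + 1) * (τ - a)` by at most `1`: the shift is at
  -- most one spacing and the count is a rounding.
  have hcard : ∀ (k : ℕ) (τ : ℝ), a < τ → τ < a + L →
      |((J k).filter (· ∈ Iio τ)).card - (k + 1) * (τ - a)| ≤ (1 : ℝ) := by
    intro k τ h1 h2
    have hk : (0 : ℝ) < k + 1 := by positivity
    -- The inequality `j < y` is strict, so the natural numbers satisfying it are counted by the
    -- ceiling of `y`.
    have e : ((J k).filter (· ∈ Iio τ)).card = ⌈(k + 1) * (τ - a - σ k)⌉₊ := by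
      rw [hJ, Finset.filter_image, Finset.card_image_of_injective _ (hinj k)]
      rw [← Finset.card_range ⌈(k + 1) * (τ - a - σ k)⌉₊]
      congr 1
      ext j
      have hiff : a + j * (k + 1 : ℝ)⁻¹ + σ k < τ ↔ (j : ℝ) < (k + 1) * (τ - a - σ k) := by
        rw [← inv_mul_lt_iff₀ hk]
        constructor <;> intro h <;> linarith
      simp only [Finset.mem_filter, Finset.mem_range, mem_Iio, hiff, Nat.lt_ceil,
        and_iff_right_iff_imp]
      intro hj
      have h3 : (k + 1) * (τ - a - σ k) ≤ (k + 1) * (L : ℝ) :=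
        mul_le_mul_of_nonneg_left (by linarith [(hσ k).1]) hk.le
      have h4 : (j : ℝ) < (L * (k + 1) : ℕ) := by
        push_cast
        linarith
      exact_mod_cast h4
    rw [e]
    have h5 : (k + 1) * σ k ≤ (1 : ℝ) := by
      have := mul_le_mul_of_nonneg_left (hσ k).2 hk.le
      rwa [mul_inv_cancel₀ hk.ne'] at this
    have h6 : 0 ≤ (k + 1) * σ k := mul_nonneg hk.le (hσ k).1.le
    have h7 := Nat.le_ceil ((k + 1) * (τ - a - σ k))
    have h8 : 0 ≤ (k + 1) * (τ - a) := mul_nonneg hk.le (by linarith)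
    have h9 : (⌈(k + 1) * (τ - a - σ k)⌉₊ : ℝ) ≤ (k + 1) * (τ - a) + 1 := by
      rcases le_total 0 ((k + 1) * (τ - a - σ k)) with h | h
      · have := (Nat.ceil_lt_add_one h).le
        linarith
      · rw [Nat.ceil_eq_zero.2 h, Nat.cast_zero]
        linarith
    rw [abs_le]
    constructor <;> linarith
  have hc : ∀ k : ℕ, t / (k + 1) ≠ 0 := fun k => div_ne_zero ht (by positivity)
  have h1 := hlsc.energy_profile_le hU hb ν ζ (fun k => stairMeasure (t / (k + 1)) (J k))
    (rampMeasure t a (a + L)) (M := t * L)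
    (fun k => by
      have hk : (k + 1 : ℝ) ≠ 0 := by positivity
      rw [stairMeasure_real _ _ MeasurableSet.univ]
      simp only [mem_univ, Finset.filter_true]
      rw [hJ, Finset.card_image_of_injective _ (hinj k), Finset.card_range]
      push_cast
      apply le_of_eq
      field_simp)
    (fun x hx => by
      obtain ⟨hx1, hx2⟩ := hstrip hx
      rw [rampMeasure_real_Iio, min_eq_right hx2.le, max_eq_left (sub_nonneg.2 hx1.le)]
      simp only [stairMeasure_real _ _ measurableSet_Iio]
      have h0 : Tendsto (fun k : ℕ => t * (k + 1 : ℝ)⁻¹) atTop (𝓝 0) := by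
        simpa using (tendsto_one_div_add_atTop_nhds_zero_nat (𝕜 := ℝ)).const_mul (t : ℝ)
      refine tendsto_iff_norm_sub_tendsto_zero.2 (squeeze_zero (fun _ => norm_nonneg _)
        (fun k => ?_) h0)
      have hk : (k + 1 : ℝ) ≠ 0 := by positivity
      have h2 := hcard k _ hx1 hx2
      have e : ((t / (k + 1) : ℝ≥0) : ℝ) * ((J k).filter (· ∈ Iio (inner ℝ x (ν : Euc d)))).card
          - t * (inner ℝ x (ν : Euc d) - a) = t * (k + 1 : ℝ)⁻¹ *
            (((J k).filter (· ∈ Iio (inner ℝ x (ν : Euc d)))).card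
              - (k + 1) * (inner ℝ x (ν : Euc d) - a)) := by
        push_cast
        field_simp
      rw [e, norm_mul, Real.norm_of_nonneg (by positivity), Real.norm_eq_abs]
      exact mul_le_of_le_one_right (by positivity) h2)
  rw [energy_ramp f g ν hζ ht _ _ hU, inter_eq_left.2 hstrip, sdiff_eq_bot_iff.2 hstrip,
    bot_eq_empty, measure_empty, mul_zero, add_zero] at h1
  refine h1.trans (liminf_le_of_frequently_le' (Frequently.of_forall fun k => ?_))
  rw [energy_stair f hg hg_hom ν hζ (hc k) _ hU, hJ, Finset.sum_image (hinj k).injOn]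
  refine add_le_add le_rfl ((mul_le_mul_right (hsum k) _).trans_eq ?_)
  have hk : ((k : ℝ≥0∞) + 1) ≠ 0 := by positivity
  have hk' : ((k : ℝ≥0∞) + 1) ≠ ⊤ := by simp
  rw [lintegral_sliceVol ν hU.measurableSet, ENNReal.coe_div (by positivity),
    ENNReal.ofReal_inv_of_pos (by positivity), div_eq_mul_inv (volume U), inv_inv]
  have e1 : ENNReal.ofReal (k + 1 : ℝ) = (k : ℝ≥0∞) + 1 := by
    rw [ENNReal.ofReal_add (by positivity) zero_le_one, ENNReal.ofReal_natCast, ENNReal.ofReal_one]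
  have e2 : (((k : ℝ≥0) + 1 : ℝ≥0) : ℝ≥0∞) = (k : ℝ≥0∞) + 1 := by push_cast; rfl
  rw [e1, e2, div_eq_mul_inv]
  calc (t : ℝ≥0∞) * ((k : ℝ≥0∞) + 1)⁻¹ * g ζ ν * (volume U * ((k : ℝ≥0∞) + 1))
      = t * g ζ ν * volume U * (((k : ℝ≥0∞) + 1)⁻¹ * ((k : ℝ≥0∞) + 1)) := by ring
    _ = t * g ζ ν * volume U := by rw [ENNReal.inv_mul_cancel hk hk', mul_one]

lemma tendsto_const_div_ofReal_atTop (c : ℝ≥0) :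
    Tendsto (fun t : ℝ => (c : ℝ≥0∞) / ENNReal.ofReal t) atTop (𝓝 0) := by
  simpa using ENNReal.Tendsto.const_div (a := (c : ℝ≥0∞)) ENNReal.tendsto_ofReal_atTop
    (Or.inr ENNReal.coe_ne_top)

lemma recession_le_surface {d : ℕ} {f : SymMat d → ℝ≥0} {g : Euc d → Sph d → ℝ≥0}
    (hg : ∀ ζ ν, g ζ ν = g (-ζ) (-ν)) (hg_hom : ∀ ζ ν, ∀ t : ℝ≥0, g (t • ζ) ν = t * g ζ ν)
    {U : Set (Euc d)} (hU : IsOpen U) (hb : Bornology.IsBounded U) (hne : U.Nonempty)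
    (hlsc : L1LowerSemicontinuous f g U) {ζ : Euc d} (hζ : ζ ≠ 0) (ν : Sph d) :
    recession f (symTensor ζ (ν : Euc d)) ≤ g ζ ν := by
  have hvol : volume U ≠ ⊤ := hb.measure_lt_top.ne
  have hvol0 : volume U ≠ 0 := (hU.measure_pos volume hne).ne'
  -- After division by `t` the contribution of `f 0` disappears in the limit.
  have hlim : Tendsto (fun t : ℝ => (f 0 : ℝ≥0∞) / ENNReal.ofReal t + g ζ ν) atTop
      (𝓝 (g ζ ν)) := by
    simpa using (tendsto_const_div_ofReal_atTop (f 0)).add_const (g ζ ν : ℝ≥0∞)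
  rw [recession, ← hlim.limsup_eq]
  refine limsup_le_limsup ?_
  filter_upwards [eventually_gt_atTop 0] with t ht
  have ht' : t.toNNReal ≠ 0 := (Real.toNNReal_pos.2 ht).ne'
  have h1 := energy_affine_le hg hg_hom hU hb hlsc hζ ν ht'
  rw [Real.coe_toNNReal t ht.le, ← add_mul, mul_comm, mul_comm (_ + _),
    ENNReal.mul_le_mul_iff_right hvol0 hvol] at h1
  have h2 : ENNReal.ofReal t ≠ 0 := (ENNReal.ofReal_pos.2 ht).ne'
  refine (ENNReal.div_le_div_right h1 _).trans_eq ?_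
  rw [ENNReal.add_div]
  congr 1
  change ENNReal.ofReal t * _ / ENNReal.ofReal t = _
  rw [mul_comm, ENNReal.mul_div_cancel_right h2 ENNReal.ofReal_ne_top]

end BDEnergy

end

theorem mainTheorem9 (d : ℕ) (c₁ c₂ c₃ c₄ : ℝ)
    (hc₁ : 0 < c₁) (hc₁₃ : c₁ ≤ c₃) (hc₂ : 0 ≤ c₂) (hc₄ : 0 ≤ c₄)
    (f : BDEnergy.SymMat d → ℝ≥0) (g : BDEnergy.Euc d → BDEnergy.Sph d → ℝ≥0)
    (hf_meas : Measurable f)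
    (hg_meas : Measurable fun p : BDEnergy.Euc d × BDEnergy.Sph d => g p.1 p.2)
    (hf : ∀ A, c₁ * BDEnergy.frob A - c₂ ≤ (f A : ℝ) ∧ (f A : ℝ) ≤ c₃ * BDEnergy.frob A + c₄)
    (hg_symm : ∀ ζ ν, g ζ ν = g (-ζ) (-ν))
    (hg : ∀ (ζ : BDEnergy.Euc d) (ν : BDEnergy.Sph d), c₁ * BDEnergy.frob (BDEnergy.symTensor ζ (ν : BDEnergy.Euc d)) ≤ (g ζ ν : ℝ) ∧
      (g ζ ν : ℝ) ≤ c₃ * BDEnergy.frob (BDEnergy.symTensor ζ (ν : BDEnergy.Euc d)))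
    (hg_hom : ∀ ζ ν, ∀ t : ℝ≥0, g (t • ζ) ν = t * g ζ ν)
    (U : Set (BDEnergy.Euc d)) (hU_open : IsOpen U) (hU_bdd : Bornology.IsBounded U)
    (hU_ne : U.Nonempty) (hlsc : BDEnergy.L1LowerSemicontinuous f g U)
    (ζ : BDEnergy.Euc d) (ν : BDEnergy.Sph d) :
    (g ζ ν : ℝ≥0∞) = BDEnergy.recession f (BDEnergy.symTensor ζ (ν : BDEnergy.Euc d)) := by
  rcases eq_or_ne ζ 0 with rfl | hζ
  · have h1 : g 0 ν = 0 := by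
      have h := (hg 0 ν).2
      rw [BDEnergy.symTensor_zero_left, BDEnergy.frob_eq_zero_iff.2 rfl, mul_zero] at h
      exact le_antisymm (by exact_mod_cast h) zero_le
    rw [h1, BDEnergy.symTensor_zero_left, BDEnergy.recession]
    -- For `ζ = 0` the recession function is the limsup of `f 0 / t`, which tends to `0`.
    simp only [smul_zero]
    rw [(BDEnergy.tendsto_const_div_ofReal_atTop (f 0)).limsup_eq, ENNReal.coe_zero]
  · exact le_antisymm
      (BDEnergy.surface_le_recession hg_symm hg_hom hU_open hU_bdd hU_ne hlsc hζ ν)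
      (BDEnergy.recession_le_surface hg_symm hg_hom hU_open hU_bdd hU_ne hlsc hζ ν)
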